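/- Consider $n \ge 1$ agents and $m \ge 0$ indivisible chores, where agent $i$ has an additive cost function $c_i$ (so $c_i(S)=\sum_{e\in S} c_i(e)$ for every set $S$ of chores) with $c_i(e)\in\{1,2\}$ for all agents $i$ and chores $e$ (a $\{1,2\}$-instance). An allocation $(X_1,\dots,X_n)$ is a partition of the chores into $n$ (possibly empty) bundles. It is EFX if for all agents $i,j$, either $X_i=\emptyset$ or $c_i(X_i\setminus\{e\})\le c_i(X_j)$ for every $e\in X_i$. It is Pareto optimal if there is no allocation $(Y_1,\dots,Y_n)$ with $c_i(Y_i)\le c_i(X_i)$ for all $i$ and strict inequality for some $i$. For every $\{1,2\}$-instance there exists an allocation that is both EFX and Pareto optimal. Moreover, such allocations can be computed in polynomial time: there is a single algorithm (a program of a random access machine with addition and subtraction at unit cost) and a polynomial $q$ such that on every $\{1,2\}$-instance with $n$ agents and $m$ chores, given by $n$, $m$ and the cost matrix, the algorithm halts after at most $q(n+m)$ steps and outputs an EFX and Pareto optimal allocation. -/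

import Mathlib

/-! ### Indivisible chores -/

namespace Chores

/-- An instance with `n` agents and `m` indivisible chores: the additive cost functions of the
agents are given by their non-negative values on single chores. -/
structure Instance (n m : ℕ) where
  /-- the cost of a chore to an agent -/
  cost : Fin n → Fin m → ℝ
  cost_nonneg : ∀ i e, 0 ≤ cost i e

/-- The additive cost of a bundle `S` to agent `i`. -/
noncomputable def Instance.bundleCost {n m : ℕ} (I : Instance n m) (i : Fin n)
    (S : Finset (Fin m)) : ℝ :=
  ∑ e ∈ S, I.cost i e

/-- A `{1,2}`-instance: every chore costs `1` or `2` to every agent. -/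
def Instance.IsOneTwo {n m : ℕ} (I : Instance n m) : Prop :=
  ∀ i e, I.cost i e = 1 ∨ I.cost i e = 2

/-- An allocation: the bundles of the agents partition the chores (bundles may be empty). -/
structure Allocation (n m : ℕ) where
  /-- the bundle of an agent -/
  bundle : Fin n → Finset (Fin m)
  disjoint : ∀ i j, i ≠ j → Disjoint (bundle i) (bundle j)
  cover : ∀ e, ∃ i, e ∈ bundle i

/-- Envy-freeness up to any item. -/
def IsEFX {n m : ℕ} (I : Instance n m) (X : Allocation n m) : Prop :=
  ∀ i j : Fin n, X.bundle i = ∅ ∨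
    ∀ e ∈ X.bundle i, I.bundleCost i ((X.bundle i).erase e) ≤ I.bundleCost i (X.bundle j)

/-- The allocation `Y` Pareto dominates the allocation `X`. -/
def ParetoDominates {n m : ℕ} (I : Instance n m) (Y X : Allocation n m) : Prop :=
  (∀ i, I.bundleCost i (Y.bundle i) ≤ I.bundleCost i (X.bundle i)) ∧
    ∃ i, I.bundleCost i (Y.bundle i) < I.bundleCost i (X.bundle i)

/-- Pareto optimality: no allocation Pareto dominates `X`. -/
def IsParetoOptimal {n m : ℕ} (I : Instance n m) (X : Allocation n m) : Prop :=
  ¬ ∃ Y : Allocation n m, ParetoDominates I Y X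

end Chores

/-! ### Random access machines

The machine has registers and one-dimensional arrays, holding natural numbers; a program, being a
finite text, uses finitely many of each. An instruction is charged one step plus one step for each
constant, register access, array access, addition and subtraction in its expressions. There is no
multiplication, so a run of `t` steps on numbers of `b` bits only produces numbers of `O(b + t)`
bits: polynomially many steps here amount to polynomial time on a Turing machine. -/

namespace RAM

/-- The memory contents. -/
structure State where
  /-- the registers -/
  reg : ℕ → ℕ
  /-- `arr a k` is the cell with index `k` of the array with name `a` -/
  arr : ℕ → ℕ → ℕ

/-- Arithmetic expressions. -/
inductive Expr where
  | const (v : ℕ)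
  | reg (x : ℕ)
  | read (a : ℕ) (index : Expr)
  | add (e f : Expr)
  | sub (e f : Expr)

/-- The value of an expression; subtraction is truncated at `0`. -/
def Expr.eval (s : State) : Expr → ℕ
  | .const v => v
  | .reg x => s.reg x
  | .read a index => s.arr a (index.eval s)
  | .add e f => e.eval s + f.eval s
  | .sub e f => e.eval s - f.eval s

/-- The number of elementary operations in an expression. -/
def Expr.size : Expr → ℕ
  | .const _ => 1
  | .reg _ => 1
  | .read _ index => index.size + 1
  | .add e f => e.size + f.size + 1
  | .sub e f => e.size + f.size + 1

/-- Programs. A guard counts as true when its value is not `0`. -/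
inductive Program where
  | skip
  | assign (x : ℕ) (e : Expr)
  | write (a : ℕ) (index e : Expr)
  | seq (p q : Program)
  | branch (guard : Expr) (p q : Program)
  | loop (guard : Expr) (p : Program)

/-- Store `v` in register `x`. -/
def State.setReg (s : State) (x v : ℕ) : State where
  reg := Function.update s.reg x v
  arr := s.arr

/-- Store `v` in the cell with index `k` of the array `a`. -/
def State.setArr (s : State) (a k v : ℕ) : State where
  reg := s.reg
  arr := Function.update s.arr a (Function.update (s.arr a) k v)

/-- `Exec p s t s'`: the program `p`, started in the state `s`, halts after exactly `t` steps in
the state `s'`. (Execution is deterministic.) -/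
inductive Exec : Program → State → ℕ → State → Prop
  | skip (s : State) : Exec .skip s 1 s
  | assign (x : ℕ) (e : Expr) (s : State) :
      Exec (.assign x e) s (e.size + 1) (s.setReg x (e.eval s))
  | write (a : ℕ) (index e : Expr) (s : State) :
      Exec (.write a index e) s (index.size + e.size + 1)
        (s.setArr a (index.eval s) (e.eval s))
  | seq {p q : Program} {s s' s'' : State} {t t' : ℕ} :
      Exec p s t s' → Exec q s' t' s'' → Exec (.seq p q) s (t + t') s''
  | branch_true {guard : Expr} {p q : Program} {s s' : State} {t : ℕ} :
      guard.eval s ≠ 0 → Exec p s t s' → Exec (.branch guard p q) s (guard.size + 1 + t) s'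
  | branch_false {guard : Expr} {p q : Program} {s s' : State} {t : ℕ} :
      guard.eval s = 0 → Exec q s t s' → Exec (.branch guard p q) s (guard.size + 1 + t) s'
  | loop_true {guard : Expr} {p : Program} {s s' s'' : State} {t t' : ℕ} :
      guard.eval s ≠ 0 → Exec p s t s' → Exec (.loop guard p) s' t' s'' →
      Exec (.loop guard p) s (guard.size + 1 + t + t') s''
  | loop_false {guard : Expr} {p : Program} {s : State} :
      guard.eval s = 0 → Exec (.loop guard p) s (guard.size + 1) s

end RAM

namespace Chores

/-- The initial memory for an instance with natural number costs: the numbers of agents and of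
chores in the registers `0` and `1`, the cost matrix row by row (the cost of chore `e` to agent `i`
has index `i * m + e`) in the array `0`, and `0` everywhere else. -/
noncomputable def Instance.toState {n m : ℕ} (I : Instance n m) : RAM.State where
  reg x := if x = 0 then n else if x = 1 then m else 0
  arr a k :=
    if h : a = 0 ∧ k < n * m then
      ⌊I.cost (Fin.divNat ⟨k, h.2⟩) (Fin.modNat ⟨k, h.2⟩)⌋₊
    else 0

/-- The memory `s` holds the allocation `X` as output: the cell with index `e` of the array `1`
names the agent that receives the chore `e`. -/
def Allocation.IsOutput {n m : ℕ} (X : Allocation n m) (s : RAM.State) : Prop :=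
  ∀ (e : Fin m) (i : Fin n), e ∈ X.bundle i ↔ s.arr 1 (e : ℕ) = (i : ℕ)

end Chores

/-! ### Priced allocations, transfers along paths, and the EFX criterion. -/

namespace Chores

open Finset Relation

/-! Give every agent weight 1 or 2, price every chore at its least weighted cost, and require the
owner to attain it. Such an equilibrium minimises the weighted total cost, so it is Pareto optimal.
All prices are 1 or 2, and `p = 1 + log₂ p` for these two values, so "the weighted cost equals the
price" reads `raised + cost = price`. The bundle price `earn` is the owner's weighted cost and a
lower bound for everybody else's weighted cost, so EFX can be tested on prices.

With weights and prices fixed, chores of one price can be passed along a path of accepting agents;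
only the two ends change their counts. `Improves` combines a price-1 path from `i` to `k` with a
price-2 path from `k` to `j`. Its four patterns are a price-1 transfer alone, a price-2 transfer
alone, an exchange between two agents, and a genuine chain in which `i` and `k` each lose one unit
and `j` gains two. Each lowers, lexicographically, the sum of squared bundle prices, then the sum of
squared price-1 counts, then minus the sum of squared price-2 counts (`Bounded.improve`).

When no pattern is available, the remaining obstruction is an agent without price-2 chores whose
load exceeds another load by at least 2. Take one of maximal load and double the weights of all
agents reachable from her at price 1, together with the prices of their chores (`Valid.raise`). This
lowers the number of agents of weight 1, so `rank`, which is polynomially bounded, decreases in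
every round.

The delicate point is a raised agent that an envious agent cannot reach. Here `Bounded N` helps:
loads are at most `2 * N`, and `supply` assigns to raised agents disjoint sets of at least `N - 1`
price-2 chores that they accept. By averaging, `le_num_two` shows that a raised agent unreachable
from weight-1 agents holds at least `N - 1` of them. The field `spread`, an assignment of the
price-1 chores with at most `N` per agent, ensures that `N` does not increase at the next raise, so
the older supply remains large enough. These facts give EFX in `Valid.efx_price`.

The algorithm runs these rounds literally. Reachability is computed by marking until nothing
changes, each loop is bounded by an integer measure, and nested loops of polynomial length give a
polynomial running time. -/

/-- A priced allocation of `m` chores among `n` agents. Agent `i` has weight `2 ^ raised i`, and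
chore `e` has logarithmic cost `cost i e + raised i` for her. -/
structure Market (n m : ℕ) where
  /-- the cost of a chore to an agent -/
  cost : ℕ → ℕ → ℕ
  /-- `1` for the agents of doubled weight, `0` for the others -/
  raised : ℕ → ℕ
  /-- the price of a chore -/
  price : ℕ → ℕ
  /-- the agent holding a chore -/
  owner : ℕ → ℕ

namespace Market

variable {n m : ℕ} {M M' M₁ M₂ : Market n m} {q x y : ℕ}

/-- The number of chores of price `q` held by `v`. -/
def num (M : Market n m) (q v : ℕ) : ℕ :=
  #{e ∈ range m | M.price e = q ∧ M.owner e = v}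

/-- The total price of the bundle of `v`. -/
def earn (M : Market n m) (v : ℕ) : ℕ := M.num 1 v + 2 * M.num 2 v

/-- The priced allocation is an equilibrium with at least one agent of weight `1`. -/
structure Valid (M : Market n m) : Prop where
  cost_eq : ∀ i < n, ∀ e < m, M.cost i e = 1 ∨ M.cost i e = 2
  raised_le : ∀ i < n, M.raised i ≤ 1
  exists_low : ∃ i < n, M.raised i = 0
  price_eq : ∀ e < m, M.price e = 1 ∨ M.price e = 2
  owner_lt : ∀ e < m, M.owner e < n
  owner_price : ∀ e < m, M.raised (M.owner e) + M.cost (M.owner e) e = M.price e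
  price_le : ∀ e < m, ∀ i < n, M.price e ≤ M.raised i + M.cost i e

/-- Agent `x` holds a chore of price `q` that `y` accepts at this price. -/
def Edge (M : Market n m) (q x y : ℕ) : Prop :=
  y < n ∧ ∃ e < m, M.price e = q ∧ M.owner e = x ∧ M.raised y + M.cost y e = q

/-- Chores of price `q` can be passed on along a path from `x` to `y`. -/
def Reach (M : Market n m) (q : ℕ) : ℕ → ℕ → Prop := ReflTransGen (M.Edge q)

/-- `M'` arises from `M` by passing on chores of price `q` along a path from `x` to `y`. -/
structure Shifted (q : ℕ) (M M' : Market n m) (x y : ℕ) : Prop where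
  cost : M'.cost = M.cost
  raised : M'.raised = M.raised
  price : M'.price = M.price
  valid : M'.Valid
  owner : ∀ e, M.price e ≠ q → M'.owner e = M.owner e
  num : ∀ v, M'.num q v + (if v = x then 1 else 0) = M.num q v + if v = y then 1 else 0

theorem num_update {e : ℕ} (he : e < m) (hq : M.price e = q) (hx : M.owner e = x) (v : ℕ) :
    num (n := n) (m := m) { M with owner := Function.update M.owner e y } q v +
        (if v = x then 1 else 0) =
      M.num q v + if v = y then 1 else 0 := by
  have hmem : e ∈ range m := mem_range.2 he
  simp only [num, card_filter]
  rw [← add_sum_erase _ _ hmem, ← add_sum_erase (range m) _ hmem]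
  have : ∀ f ∈ (range m).erase e,
      (if M.price f = q ∧ Function.update M.owner e y f = v then 1 else 0) =
      if M.price f = q ∧ M.owner f = v then 1 else 0 := by
    intro f hf
    rw [Function.update_of_ne (ne_of_mem_erase hf)]
  rw [sum_congr rfl this]
  simp only [hq, hx, Function.update_self, true_and]
  simp only [eq_comm (a := v)]
  omega

theorem Shifted.refl (h : M.Valid) : Shifted q M M x x :=
  ⟨rfl, rfl, rfl, h, fun _ _ => rfl, fun _ => rfl⟩

/-- Paths are processed from their end: `cur` has already given a chore away, and receiving `e`
restores her count and moves the deficit to the previous owner. -/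
theorem Shifted.step {cur : ℕ} (h : Shifted q M M' cur y) {e : ℕ} (he : e < m)
    (hq : M.price e = q) (hx : M'.owner e = x) (hc : cur < n)
    (hacc : M.raised cur + M.cost cur e = q) :
    Shifted q M { M' with owner := Function.update M'.owner e cur } x y where
  cost := h.cost
  raised := h.raised
  price := h.price
  valid := by
    refine ⟨h.valid.cost_eq, h.valid.raised_le, h.valid.exists_low, h.valid.price_eq, ?_, ?_,
      h.valid.price_le⟩
    · intro f hf
      by_cases hfe : f = e
      · subst hfe; simpa using hc
      · simpa [Function.update_of_ne hfe] using h.valid.owner_lt f hf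
    · intro f hf
      by_cases hfe : f = e
      · subst hfe; simp [h.raised, h.cost, h.price, hacc, hq]
      · simpa [Function.update_of_ne hfe] using h.valid.owner_price f hf
  owner f hf := by
    have hfe : f ≠ e := by rintro rfl; exact hf hq
    simpa [Function.update_of_ne hfe] using h.owner f hf
  num v := by
    have h1 := num_update (M := M') (y := cur) he (h.price ▸ hq) hx v
    have h2 := h.num v
    omega

theorem Shifted.num_of_ne {q' : ℕ} (h : Shifted q M M' x y) (hq : q' ≠ q) (v : ℕ) :
    M'.num q' v = M.num q' v := by
  unfold Market.num
  congr 1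
  ext e
  simp only [mem_filter, h.price, and_congr_right_iff]
  rintro - he
  rw [h.owner e (he ▸ hq)]

/-- To an agent of weight 2 every chore has weighted cost at least 2. -/
theorem Valid.num_one_of_raised (h : M.Valid) {v : ℕ} (hv : M.raised v = 1) (hn : v < n) :
    M.num 1 v = 0 := by
  simp only [num, card_eq_zero, filter_eq_empty_iff, mem_range]
  rintro e he ⟨h1, rfl⟩
  have := h.owner_price e he
  rcases h.cost_eq _ hn e he with h2 | h2 <;> omega

theorem num_pos_iff {v : ℕ} : 0 < M.num q v ↔ ∃ e < m, M.price e = q ∧ M.owner e = v := by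
  simp [num, card_pos, Finset.Nonempty]

theorem Edge.num_pos (h : M.Edge q x y) : 0 < M.num q x := by
  obtain ⟨-, e, he, h1, h2, -⟩ := h
  exact num_pos_iff.2 ⟨e, he, h1, h2⟩

theorem Reach.num_pos (h : M.Reach q x y) (hne : x ≠ y) : 0 < M.num q x := by
  rcases ReflTransGen.cases_head h with rfl | ⟨z, hz, -⟩
  · exact absurd rfl hne
  · exact hz.num_pos

theorem Reach.lt (h : M.Reach q x y) (hx : x < n) : y < n := by
  rcases ReflTransGen.cases_tail h with rfl | ⟨z, -, hz⟩
  · exact hx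
  · exact hz.1

/-- Weight-1 agents value every chore at most 2, so they accept every price-2 chore. Hence any
holder of such a chore reaches all of them in one step. -/
theorem Valid.edge_two (h : M.Valid) (hx : 0 < M.num 2 x) (hy : y < n) (hr : M.raised y = 0) :
    M.Edge 2 x y := by
  obtain ⟨e, he, h1, h2⟩ := num_pos_iff.1 hx
  have := h.price_le e he y hy
  refine ⟨hy, e, he, h1, h2, ?_⟩
  rcases h.cost_eq y hy e he with h3 | h3 <;> omega

theorem Valid.raised_of_reach_one (h : M.Valid) (hxy : M.Reach 1 x y) (hx : M.raised x = 0) :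
    M.raised y = 0 := by
  rcases ReflTransGen.cases_tail hxy with rfl | ⟨z, -, hy, e, he, -, -, h1⟩
  · exact hx
  · rcases h.cost_eq y hy e he with h3 | h3 <;> omega

/-- The triples `(i, k, j)` for which passing a chore of price `1` from `i` to `k` and a chore of
price `2` from `k` to `j` is an improvement. -/
def Improves (M : Market n m) (i k j : ℕ) : Prop :=
  (k = j ∧ M.earn k + 2 ≤ M.earn i) ∨
  (i = k ∧ (M.earn j + 3 ≤ M.earn i ∨
    (M.earn j + 2 ≤ M.earn i ∧ 0 < M.num 1 i ∧ M.num 1 j = 0))) ∨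
  (i = j ∧ M.earn j + 2 ≤ M.earn k) ∨
  (i ≠ k ∧ M.num 2 i = 0 ∧ M.earn i ≤ M.earn k + 1 ∧ M.earn j + 2 ≤ M.earn i)

/-- No improving triple is available. -/
def Stuck (M : Market n m) : Prop :=
  ∀ i < n, ∀ k < n, ∀ j < n, M.Reach 1 i k → M.Reach 2 k j → ¬ M.Improves i k j

/-- The bounds that certify that raised agents keep enough chores. -/
structure Bounded (M : Market n m) (N : ℕ) : Prop where
  earn_le : ∀ v < n, M.earn v ≤ 2 * N
  earn_lt : ∀ v < n, 0 < M.num 1 v → M.earn v < 2 * N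
  supply : ∃ z : ℕ → ℕ, ∀ u < n, M.raised u = 1 →
    N ≤ #{e ∈ range m | (M.price e = 2 ∧ M.raised u + M.cost u e = 2) ∧ z e = u} + 1
  spread : ∃ z : ℕ → ℕ, (∀ e < m, M.price e = 1 →
      z e < n ∧ M.raised (z e) + M.cost (z e) e = 1) ∧
    ∀ v < n, #{e ∈ range m | M.price e = 1 ∧ z e = v} ≤ N

/-- The double counting behind the averaging arguments, used both for owners and for the assignments
in `Bounded`. -/
theorem sum_card_fiber (S : Finset ℕ) (P : ℕ → Prop) [DecidablePred P] (z : ℕ → ℕ) :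
    ∑ s ∈ S, #{e ∈ range m | P e ∧ z e = s} = #{e ∈ range m | P e ∧ z e ∈ S} := by
  classical
  rw [card_eq_sum_card_fiberwise (f := z) (t := S)]
  · refine sum_congr rfl fun s hs => ?_
    congr 1
    ext e
    simp only [mem_filter]
    constructor
    · rintro ⟨h1, h2, rfl⟩; exact ⟨⟨h1, h2, hs⟩, rfl⟩
    · rintro ⟨⟨h1, h2, -⟩, rfl⟩; exact ⟨h1, h2, rfl⟩
  · intro e he
    exact (mem_filter.1 he).2.2

/-- Everything the agents with access to the raised agent `y` accept is held by them. -/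
theorem Valid.le_num_two (h : M.Valid) (hs : M.Stuck) {N : ℕ} (hb : M.Bounded N) (hy : y < n)
    (hr : M.raised y = 1) (hlow : ∀ l < n, M.raised l = 0 → ¬ M.Reach 2 l y) :
    N ≤ M.num 2 y + 1 := by
  classical
  obtain ⟨z, hz⟩ := hb.supply
  set S := {s ∈ range n | M.Reach 2 s y} with hS
  have hyS : y ∈ S := by
    rw [hS, mem_filter]
    exact ⟨mem_range.2 hy, ReflTransGen.refl⟩
  have hraised : ∀ s ∈ S, M.raised s = 1 := by
    intro s hsS
    simp only [hS, mem_filter, mem_range] at hsS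
    have := h.raised_le s hsS.1
    have : M.raised s ≠ 0 := fun h0 => hlow s hsS.1 h0 hsS.2
    omega
  -- Both agents hold only price-2 chores, so a larger gap would be a bundle price difference of at
  -- least 4, which a price-2 transfer improves.
  have hle : ∀ s ∈ S, M.num 2 s ≤ M.num 2 y + 1 := by
    intro s hsS
    have hr' := hraised s hsS
    simp only [hS, mem_filter, mem_range] at hsS
    have h1 := h.num_one_of_raised hr' hsS.1
    have h2 := h.num_one_of_raised hr hy
    have h3 := hs s hsS.1 s hsS.1 y hy ReflTransGen.refl hsS.2
    unfold Improves earn at h3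
    omega
  have h1 : ∑ s ∈ S, N ≤ ∑ s ∈ S, (#{e ∈ range m | (M.price e = 2 ∧
      M.raised (z e) + M.cost (z e) e = 2) ∧ z e = s} + 1) := by
    refine sum_le_sum fun s hsS => ?_
    have h2 := hz s (by simp only [hS, mem_filter, mem_range] at hsS; exact hsS.1) (hraised s hsS)
    refine h2.trans (Nat.add_le_add_right (card_le_card fun e => ?_) 1)
    simp only [mem_filter]
    rintro ⟨h1, h2, rfl⟩
    exact ⟨h1, h2, rfl⟩
  rw [sum_add_distrib, sum_card_fiber] at h1
  -- The owner of a chore reserved for a member of `S` has an edge to that member, hence reaches `y`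
  -- and lies in `S` too.
  have h2 : #{e ∈ range m | (M.price e = 2 ∧ M.raised (z e) + M.cost (z e) e = 2) ∧ z e ∈ S} ≤
      #{e ∈ range m | M.price e = 2 ∧ M.owner e ∈ S} := by
    refine card_le_card fun e => ?_
    simp only [hS, mem_filter, mem_range]
    rintro ⟨he, ⟨h3, h4⟩, h5, h6⟩
    exact ⟨he, h3, h.owner_lt e he, ReflTransGen.head ⟨h5, e, he, h3, rfl, h4⟩ h6⟩
  rw [← sum_card_fiber S (fun e => M.price e = 2)] at h2
  -- The strictness at `y` itself gains the unit needed after dividing by the size of `S`.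
  have h3 : ∑ s ∈ S, M.num 2 s < ∑ s ∈ S, (M.num 2 y + 1) :=
    sum_lt_sum hle ⟨y, hyS, by omega⟩
  have h4 : ∑ s ∈ S, #{e ∈ range m | M.price e = 2 ∧ M.owner e = s} = ∑ s ∈ S, M.num 2 s := rfl
  rw [h4] at h2
  simp only [sum_const, smul_eq_mul, mul_one] at h1 h3
  have h5 : #S * N < #S * (M.num 2 y + 2) := by
    rw [mul_add] at h3 ⊢
    omega
  have := Nat.lt_of_mul_lt_mul_left h5
  omega

/-- No agent without chores of price `2` is to be raised. -/
def Settled (M : Market n m) : Prop :=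
  ∀ i < n, M.num 2 i = 0 → ∀ j < n, M.earn i ≤ M.earn j + 1

/-- The cost to `x` of the bundle of `y`. -/
def bundleCost (M : Market n m) (x y : ℕ) : ℕ := ∑ e ∈ range m with M.owner e = y, M.cost x e

theorem Valid.earn_eq_sum (h : M.Valid) (y : ℕ) :
    M.earn y = ∑ e ∈ range m with M.owner e = y, M.price e := by
  have h1 : ∀ e ∈ range m, (if M.owner e = y then M.price e else 0) =
      (if M.price e = 1 ∧ M.owner e = y then 1 else 0) +
        2 * (if M.price e = 2 ∧ M.owner e = y then 1 else 0) := by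
    intro e he
    by_cases hy : M.owner e = y
    · rcases h.price_eq e (mem_range.1 he) with h2 | h2 <;> simp [h2, hy]
    · simp [hy]
  rw [sum_filter, sum_congr rfl h1, sum_add_distrib, ← mul_sum]
  simp [earn, num]

/-- Translation from the logarithmic to the multiplicative form; the weight `2 ^ raised` equals
`raised + 1` because `raised` is 0 or 1. -/
theorem Valid.price_le_weight (h : M.Valid) {e : ℕ} (he : e < m) (hx : x < n) :
    M.price e ≤ (M.raised x + 1) * M.cost x e := by
  have h1 := h.price_le e he x hx
  have h2 := h.raised_le x hx
  have h3 := h.price_eq e he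
  rcases h.cost_eq x hx e he with h4 | h4 <;> rw [h4] at h1 ⊢ <;> omega

theorem Valid.price_owner (h : M.Valid) {e : ℕ} (he : e < m) :
    M.price e = (M.raised (M.owner e) + 1) * M.cost (M.owner e) e := by
  have h1 := h.owner_price e he
  have h2 := h.raised_le _ (h.owner_lt e he)
  have h3 := h.price_eq e he
  rcases h.cost_eq _ (h.owner_lt e he) e he with h4 | h4 <;> rw [h4] at h1 ⊢ <;> omega

theorem Valid.earn_le_bundleCost (h : M.Valid) (hx : x < n) (y : ℕ) :
    M.earn y ≤ (M.raised x + 1) * M.bundleCost x y := by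
  rw [h.earn_eq_sum, bundleCost, mul_sum]
  exact sum_le_sum fun e he => h.price_le_weight (by simpa using (mem_filter.1 he).1) hx

theorem Valid.earn_eq_bundleCost (h : M.Valid) (x : ℕ) :
    M.earn x = (M.raised x + 1) * M.bundleCost x x := by
  rw [h.earn_eq_sum, bundleCost, mul_sum]
  refine sum_congr rfl fun e he => ?_
  obtain ⟨h1, rfl⟩ := mem_filter.1 he
  exact h.price_owner (by simpa using h1)

theorem Valid.earn_lt_bundleCost (h : M.Valid) (hx : x < n) {y e : ℕ} (he : e < m)
    (hy : M.owner e = y) (hlt : M.price e < (M.raised x + 1) * M.cost x e) :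
    M.earn y < (M.raised x + 1) * M.bundleCost x y := by
  rw [h.earn_eq_sum, bundleCost, mul_sum]
  exact sum_lt_sum (fun f hf => h.price_le_weight (by simpa using (mem_filter.1 hf).1) hx)
    ⟨e, by simp [he, hy], hlt⟩

/-- A bounded equilibrium without improving triples and agents to be raised is EFX. -/
theorem Valid.efx_price (h : M.Valid) (hs : M.Stuck) (ht : M.Settled) {N : ℕ} (hb : M.Bounded N)
    {e : ℕ} (he : e < m) (hx : M.owner e = x) (hy : y < n) :
    M.earn x ≤ (M.raised x + 1) * M.bundleCost x y + M.price e := by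
  have hxn : x < n := hx ▸ h.owner_lt e he
  have hle := h.earn_le_bundleCost hxn y
  have hpe := h.price_eq e he
  have hpos : 0 < M.num (M.price e) x := num_pos_iff.2 ⟨e, he, rfl, hx⟩
  by_cases hb0 : M.num 2 x = 0
  · have := ht x hxn hb0 y hy
    omega
  have hb1 : 0 < M.num 2 x := Nat.pos_of_ne_zero hb0
  have key : M.Reach 2 x y → M.earn x ≤ M.earn y + 2 ∧
      (M.earn x = M.earn y + 2 → 0 < M.num 1 x → 0 < M.num 1 y) := by
    intro hr
    have h3 := hs x hxn x hxn y hy ReflTransGen.refl hr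
    unfold Improves at h3
    omega
  have hr1 := h.raised_le y hy
  by_cases hr : M.raised y = 0
  · have hreach : M.Reach 2 x y := ReflTransGen.single (h.edge_two hb1 hy hr)
    have h3 := key hreach
    by_contra hcon
    have he1 : M.price e = 1 := by omega
    rw [he1] at hpos hcon
    have h4 : M.earn x = M.earn y + 2 := by omega
    obtain ⟨f, hf, hf1, hf2⟩ := num_pos_iff.1 (h3.2 h4 hpos)
    -- If `x` did not accept `f` at price 1, she would value the bundle of `y` strictly above its
    -- price, which supplies the missing unit. Otherwise exchanging `f` for a price-2 chore of `x`
    -- is the third improving pattern.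
    have hedge : M.Reach 1 y x := by
      refine ReflTransGen.single ⟨hxn, f, hf, hf1, hf2, ?_⟩
      by_contra hne
      have h5 := h.price_le f hf x hxn
      have h6 := h.earn_lt_bundleCost hxn hf hf2 (by
        rcases h.cost_eq x hxn f hf with h6 | h6 <;> rw [h6] at h5 hne ⊢ <;> omega)
      omega
    refine hs y hy x hxn y hy hedge hreach ?_
    unfold Improves
    omega
  · have hr : M.raised y = 1 := by omega
    have hy1 := h.num_one_of_raised hr hy
    by_cases hreach : M.Reach 2 x y
    · have h3 := key hreach
      rcases hpe with h4 | h4 <;> rw [h4] at hpos ⊢ <;> omega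
    -- Since `x` reaches every weight-1 agent, none of them reaches `y`. Thus `earn y` is at least
    -- `2 * N - 2`, and the two load bounds cover removal of a price-2 and of a price-1 chore
    -- respectively.
    · have h5 := h.le_num_two hs hb hy hr (fun l hl hl0 hly =>
        hreach (ReflTransGen.head (h.edge_two hb1 hl hl0) hly))
      have h6 := hb.earn_le x hxn
      have h7 := hb.earn_lt x hxn
      have h8 : M.earn y = 2 * M.num 2 y := by simp [earn, hy1]
      rcases hpe with h4 | h4 <;> rw [h4] at hpos ⊢ <;> omega

end Market
end Chores

/-! ### The potential and its decrease under improving moves. -/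

namespace Chores

open Finset Relation

/-- One formula serves all improving patterns: the last summand corrects for coincidences among the
three agents. -/
theorem sum_sq_perturb (n : ℕ) (f : ℕ → ℤ) {x y z : ℕ} (hx : x < n) (hy : y < n) (hz : z < n)
    (α β γ : ℤ) :
    ∑ v ∈ range n, (f v + ((if v = x then α else 0) + (if v = y then β else 0) +
      (if v = z then γ else 0))) ^ 2 =
    ∑ v ∈ range n, f v ^ 2 + 2 * (α * f x + β * f y + γ * f z) + (α ^ 2 + β ^ 2 + γ ^ 2) +
      2 * ((if x = y then α * β else 0) + (if x = z then α * γ else 0) +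
        (if y = z then β * γ else 0)) := by
  have h : ∀ v ∈ range n, (f v + ((if v = x then α else 0) + (if v = y then β else 0) +
      (if v = z then γ else 0))) ^ 2 =
      f v ^ 2 + (if v = x then 2 * α * f x + α ^ 2 +
        2 * ((if x = y then α * β else 0) + (if x = z then α * γ else 0)) else 0) +
      (if v = y then 2 * β * f y + β ^ 2 + 2 * (if y = z then β * γ else 0) else 0) +
      (if v = z then 2 * γ * f z + γ ^ 2 else 0) := by
    intro v _
    by_cases h1 : v = x
    · subst h1
      by_cases h2 : v = y
      · subst h2
        by_cases h3 : v = z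
        · subst h3; simp; ring
        · simp [h3]; ring
      · by_cases h3 : v = z
        · subst h3; simp [h2]; ring
        · simp [h2, h3]; ring
    · by_cases h2 : v = y
      · subst h2
        by_cases h3 : v = z
        · subst h3; simp [h1]; ring
        · simp [h1, h3]; ring
      · by_cases h3 : v = z
        · subst h3; simp [h1, h2]; ring
        · simp [h1, h2, h3]
  rw [sum_congr rfl h]
  simp only [sum_add_distrib, sum_ite_eq', mem_range, hx, hy, hz, if_true]
  ring

namespace Market

variable {n m : ℕ} {M M' M₁ M₂ : Market n m}

/-- The sum of the squared numbers of chores of price `q`. -/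
def sqNum (M : Market n m) (q : ℕ) : ℕ := ∑ v ∈ range n, M.num q v ^ 2

/-- The sum of the squared bundle prices. -/
def sqEarn (M : Market n m) : ℕ := ∑ v ∈ range n, M.earn v ^ 2

theorem sum_num_le (M : Market n m) (q : ℕ) : ∑ v ∈ range n, M.num q v ≤ m := by
  have := sum_card_fiber (m := m) (range n) (fun e => M.price e = q) M.owner
  unfold num
  rw [this]
  simpa using card_filter_le (range m) (fun e => M.price e = q ∧ M.owner e ∈ range n)

theorem sum_sq_le_sq_sum (f : ℕ → ℕ) (n : ℕ) :
    ∑ v ∈ range n, f v ^ 2 ≤ (∑ v ∈ range n, f v) ^ 2 :=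
  sum_sq_le_sq_sum_of_nonneg fun _ _ => Nat.zero_le _

theorem sqNum_le (M : Market n m) (q : ℕ) : M.sqNum q ≤ m ^ 2 :=
  (sum_sq_le_sq_sum _ _).trans (Nat.pow_le_pow_left (M.sum_num_le q) 2)

theorem sqEarn_le (M : Market n m) : M.sqEarn ≤ (3 * m) ^ 2 := by
  refine (sum_sq_le_sq_sum _ _).trans (Nat.pow_le_pow_left ?_ 2)
  have h1 := M.sum_num_le 1
  have h2 := M.sum_num_le 2
  simp only [earn, sum_add_distrib, ← mul_sum]
  omega

/-- The potential that encodes the lexicographic order of the sums of squares. -/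
def potential (M : Market n m) : ℕ :=
  (M.sqEarn * (m ^ 2 + 1) + M.sqNum 1) * (m ^ 2 + 1) + (m ^ 2 - M.sqNum 2)

/-- A strict upper bound of the potential. -/
def potentialBound (m : ℕ) : ℕ :=
  ((3 * m) ^ 2 * (m ^ 2 + 1) + m ^ 2) * (m ^ 2 + 1) + m ^ 2 + 1

theorem potential_lt (M : Market n m) : M.potential < potentialBound m := by
  have h1 := M.sqEarn_le
  have h2 := M.sqNum_le 1
  have h3 : m ^ 2 - M.sqNum 2 ≤ m ^ 2 := Nat.sub_le _ _
  have h4 : (M.sqEarn * (m ^ 2 + 1) + M.sqNum 1) * (m ^ 2 + 1) ≤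
      ((3 * m) ^ 2 * (m ^ 2 + 1) + m ^ 2) * (m ^ 2 + 1) := by gcongr
  unfold potential potentialBound
  omega

theorem lex_lt {D a b d a' b' d' : ℕ} (hb : b < D) (hd : d < D)
    (h : a < a' ∨ (a = a' ∧ b < b') ∨ (a = a' ∧ b = b' ∧ d < d')) :
    (a * D + b) * D + d < (a' * D + b') * D + d' := by
  have key : ∀ {x x' y : ℕ}, y < D → x < x' → x * D + y < x' * D := by
    intro x x' y hy hx
    have := Nat.mul_le_mul_right D (Nat.succ_le_of_lt hx)
    rw [Nat.succ_mul] at this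
    omega
  rcases h with h | ⟨rfl, h⟩ | ⟨rfl, rfl, h⟩
  · have h1 := key hb h
    have h2 := key hd (h1.trans_le (Nat.le_add_right _ b'))
    omega
  · have h2 := key hd (Nat.add_lt_add_left h (a * D))
    omega
  · omega

theorem potential_lt_of_lex (h : M₂.sqEarn < M.sqEarn ∨
    (M₂.sqEarn = M.sqEarn ∧ M₂.sqNum 1 < M.sqNum 1) ∨
    (M₂.sqEarn = M.sqEarn ∧ M₂.sqNum 1 = M.sqNum 1 ∧ M.sqNum 2 < M₂.sqNum 2)) :
    M₂.potential < M.potential := by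
  have h1 := M₂.sqNum_le 1
  have h2 := M.sqNum_le 2
  have h3 := M₂.sqNum_le 2
  refine lex_lt (by omega) (by omega) ?_
  rcases h with h | h | h
  · exact .inl h
  · exact .inr (.inl h)
  · exact .inr (.inr ⟨h.1, h.2.1, by omega⟩)

/-- The number of agents that may still be raised, combined with the potential. -/
def rank (M : Market n m) : ℕ :=
  #{v ∈ range n | M.raised v = 0} * potentialBound m + M.potential

theorem rank_le (M : Market n m) : M.rank ≤ (n + 1) * potentialBound m := by
  have h1 := M.potential_lt
  have h2 : #{v ∈ range n | M.raised v = 0} ≤ n := by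
    simpa using card_filter_le (range n) (fun v => M.raised v = 0)
  have h3 := Nat.mul_le_mul_right (potentialBound m) h2
  unfold rank
  rw [Nat.succ_mul]
  omega

theorem Bounded.of_eq {N : ℕ} (hb : M.Bounded N) (h1 : M'.cost = M.cost)
    (h2 : M'.raised = M.raised) (h3 : M'.price = M.price) (h4 : ∀ v < n, M'.earn v ≤ 2 * N)
    (h5 : ∀ v < n, 0 < M'.num 1 v → M'.earn v < 2 * N) : M'.Bounded N :=
  ⟨h4, h5, by rw [h1, h2, h3]; exact hb.supply, by rw [h1, h2, h3]; exact hb.spread⟩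

/-- Improving moves keep the bounds and decrease the rank. -/
theorem Bounded.improve {N i k j : ℕ} (hb : M.Bounded N) (h1 : Shifted 1 M M₁ i k)
    (h2 : Shifted 2 M₁ M₂ k j) (hi : i < n) (hk : k < n) (hj : j < n)
    (himp : M.Improves i k j) : M₂.Bounded N ∧ M₂.rank < M.rank := by
  have n1 : ∀ v, M₂.num 1 v + (if v = i then 1 else 0) = M.num 1 v + if v = k then 1 else 0 := by
    intro v
    rw [h2.num_of_ne (by norm_num)]
    exact h1.num v
  have n2 : ∀ v, M₂.num 2 v + (if v = k then 1 else 0) = M.num 2 v + if v = j then 1 else 0 := by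
    intro v
    rw [← h1.num_of_ne (by norm_num)]
    exact h2.num v
  -- A gaining agent ends no higher than a donor was before the move. When she can end equally high,
  -- either she holds no price-1 chore or that donor held one and was strictly below `2 * N`.
  have hN : ∀ v < n, M₂.earn v ≤ 2 * N ∧ (0 < M₂.num 1 v → M₂.earn v < 2 * N) := by
    intro v hv
    have a1 := n1 v
    have a2 := n2 v
    have b1 := hb.earn_le v hv
    have b2 := hb.earn_lt v hv
    have b3 := hb.earn_le i hi
    have b4 := hb.earn_lt i hi
    have b5 := hb.earn_le k hk
    have b6 := hb.earn_lt k hk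
    unfold Improves at himp
    unfold earn at *
    by_cases e1 : v = i <;> by_cases e2 : v = k <;> by_cases e3 : v = j <;>
      simp only [e1, e2, e3, if_true, if_false] at a1 a2 <;> subst_vars <;>
      simp_all only [if_true, if_false, not_true, ne_eq, true_and, false_and, or_false, false_or] <;>
      omega
  refine ⟨hb.of_eq (h2.cost.trans h1.cost) (h2.raised.trans h1.raised) (h2.price.trans h1.price)
    (fun v hv => (hN v hv).1) (fun v hv => (hN v hv).2), ?_⟩
  have hr : M₂.raised = M.raised := h2.raised.trans h1.raised
  suffices M₂.potential < M.potential by unfold rank; rw [hr]; omega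
  have hP : (M₂.sqEarn : ℤ) = M.sqEarn + 2 * (-1 * M.earn i + -1 * M.earn k + 2 * M.earn j) +
      ((-1) ^ 2 + (-1) ^ 2 + 2 ^ 2) + 2 * ((if i = k then -1 * -1 else 0) +
        (if i = j then -1 * 2 else 0) + (if k = j then -1 * 2 else 0)) := by
    unfold sqEarn
    simp only [Nat.cast_sum, Nat.cast_pow]
    rw [← sum_sq_perturb n (fun v => (M.earn v : ℤ)) hi hk hj]
    refine sum_congr rfl fun v _ => ?_
    congr 1
    have a1 := n1 v
    have a2 := n2 v
    unfold earn
    split_ifs at a1 a2 ⊢ <;> omega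
  have hA : (M₂.sqNum 1 : ℤ) = M.sqNum 1 + 2 * (-1 * M.num 1 i + 1 * M.num 1 k + 0 * M.num 1 j) +
      ((-1) ^ 2 + 1 ^ 2 + 0 ^ 2) + 2 * ((if i = k then -1 * 1 else 0) +
        (if i = j then -1 * 0 else 0) + (if k = j then 1 * 0 else 0)) := by
    unfold sqNum
    simp only [Nat.cast_sum, Nat.cast_pow]
    rw [← sum_sq_perturb n (fun v => (M.num 1 v : ℤ)) hi hk hj]
    refine sum_congr rfl fun v _ => ?_
    congr 1
    have a1 := n1 v
    split_ifs at a1 ⊢ <;> omega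
  have hB : (M₂.sqNum 2 : ℤ) = M.sqNum 2 + 2 * (0 * M.num 2 i + -1 * M.num 2 k + 1 * M.num 2 j) +
      (0 ^ 2 + (-1) ^ 2 + 1 ^ 2) + 2 * ((if i = k then 0 * -1 else 0) +
        (if i = j then 0 * 1 else 0) + (if k = j then -1 * 1 else 0)) := by
    unfold sqNum
    simp only [Nat.cast_sum, Nat.cast_pow]
    rw [← sum_sq_perturb n (fun v => (M.num 2 v : ℤ)) hi hk hj]
    refine sum_congr rfl fun v _ => ?_
    congr 1
    have a2 := n2 v
    split_ifs at a2 ⊢ <;> omega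
  -- Needed for a tie in the chain pattern: there `k` has one unit less than `i` and also holds a
  -- price-2 chore, so her price-1 count is well below that of `i` and `sqNum 1` drops.
  have hki : k ≠ j → 0 < M.num 2 k := by
    intro hne
    have := n2 k
    simp only [hne, if_true, if_false] at this
    omega
  clear hN n1 n2 hb h1 h2 hr
  apply potential_lt_of_lex
  unfold Improves at himp
  unfold earn at *
  norm_num at hP hA hB
  -- The other tie is a price-2 transfer at difference exactly 2. The loads are interchanged, and
  -- the receiver, having no price-1 chores, already holds at least as many price-2 chores as the
  -- donor, so `sqNum 2` grows.
  split_ifs at hP hA hB <;> subst_vars <;> omega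

end Market
end Chores

/-! ### Raising the weights of a set of agents. -/

namespace Chores

open Finset Relation

namespace Market

variable {n m : ℕ} {M M' M₁ M₂ : Market n m}

/-- `M'` arises from `M` by doubling the weights of the agents in `R`. -/
structure IsRaise (M M' : Market n m) (R : ℕ → Prop) : Prop where
  cost : M'.cost = M.cost
  owner : M'.owner = M.owner
  raised_of : ∀ v < n, R v → M'.raised v = 1
  raised_of_not : ∀ v < n, ¬ R v → M'.raised v = M.raised v
  price_of : ∀ e < m, R (M.owner e) → M'.price e = 2
  price_of_not : ∀ e < m, ¬ R (M.owner e) → M'.price e = M.price e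

/-- As `R` is closed under price-1 edges, every outsider values the chores of `R` at 2 or more, so
doubling their prices from 1 to 2 undercuts nobody. -/
theorem Valid.isRaise {R : ℕ → Prop} (h : M.Valid) (hM : IsRaise M M' R)
    (hR0 : ∀ v < n, R v → M.raised v = 0) (hR2 : ∀ v < n, R v → M.num 2 v = 0)
    (hRc : ∀ v w, R v → M.Edge 1 v w → R w) (hlow : ∃ v < n, ¬ R v ∧ M.raised v = 0) :
    M'.Valid where
  cost_eq := hM.cost ▸ h.cost_eq
  raised_le v hv := by
    by_cases hR : R v
    · exact (hM.raised_of v hv hR).le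
    · exact (hM.raised_of_not v hv hR).trans_le (h.raised_le v hv)
  exists_low := by
    obtain ⟨v, hv, h1, h2⟩ := hlow
    exact ⟨v, hv, (hM.raised_of_not v hv h1).trans h2⟩
  price_eq e he := by
    by_cases hR : R (M.owner e)
    · exact .inr (hM.price_of e he hR)
    · rw [hM.price_of_not e he hR]; exact h.price_eq e he
  owner_lt := hM.owner ▸ h.owner_lt
  owner_price e he := by
    have ho := h.owner_lt e he
    rw [hM.owner, hM.cost]
    by_cases hR : R (M.owner e)
    · rw [hM.raised_of _ ho hR, hM.price_of e he hR]
      have h1 := h.owner_price e he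
      have h2 := hR0 _ ho hR
      have h3 : M.price e ≠ 2 := fun h3 => by
        have : 0 < M.num 2 (M.owner e) := num_pos_iff.2 ⟨e, he, h3, rfl⟩
        have := hR2 _ ho hR
        omega
      have := h.price_eq e he
      omega
    · rw [hM.raised_of_not _ ho hR, hM.price_of_not e he hR]
      exact h.owner_price e he
  price_le e he v hv := by
    rw [hM.cost]
    have h1 := h.price_le e he v hv
    have h2 := h.price_eq e he
    have h4 := h.cost_eq v hv e he
    by_cases hR : R (M.owner e)
    · rw [hM.price_of e he hR]
      by_cases hv' : R v
      · rw [hM.raised_of v hv hv']; omega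
      · rw [hM.raised_of_not v hv hv']
        by_contra hcon
        have h5 : M.price e = 1 := by omega
        exact hv' (hRc _ _ hR ⟨hv, e, he, h5, rfl, by omega⟩)
    · rw [hM.price_of_not e he hR]
      by_cases hv' : R v
      · rw [hM.raised_of v hv hv']; omega
      · rw [hM.raised_of_not v hv hv']; exact h1

/-- When no move is available, an agent of maximal load without chores of price `2` and the agents
with access to her chores can be raised. -/
theorem Valid.raise {N i j : ℕ} (h : M.Valid) (hs : M.Stuck) (hb : M.Bounded N) (hi : i < n)
    (hi2 : M.num 2 i = 0) (hmax : ∀ v < n, M.num 2 v = 0 → M.num 1 v ≤ M.num 1 i) (hj : j < n)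
    (hji : M.earn j + 2 ≤ M.earn i) (hM : IsRaise M M' (M.Reach 1 i)) :
    M'.Valid ∧ (∃ N', M'.Bounded N') ∧ M'.rank < M.rank := by
  classical
  have hei : M.earn i = M.num 1 i := by simp [earn, hi2]
  have hi1 : 0 < M.num 1 i := by omega
  have hri : M.raised i = 0 := by
    by_contra hne
    have := h.raised_le i hi
    have := h.num_one_of_raised (v := i) (by omega) hi
    omega
  have hlt : M.earn i < 2 * N := hb.earn_lt i hi hi1
  have hRlt : ∀ v, M.Reach 1 i v → v < n := fun v hv => hv.lt hi
  have hR0 : ∀ v, M.Reach 1 i v → M.raised v = 0 := fun v hv => h.raised_of_reach_one hv hri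
  have hRe : ∀ v, M.Reach 1 i v → M.earn i ≤ M.earn v + 1 := by
    intro v hv
    have := hs i hi v (hRlt v hv) v (hRlt v hv) hv ReflTransGen.refl
    unfold Improves at this
    omega
  -- A price-2 chore at `k` would complete the chain pattern if `k` reached `j`. Otherwise no
  -- weight-1 agent reaches `j`, and the averaging bound makes `earn j` too large for `earn j + 2 ≤
  -- earn i < 2 * N`.
  have hR2 : ∀ v, M.Reach 1 i v → M.num 2 v = 0 := by
    intro k hk
    by_contra hne
    have hpos : 0 < M.num 2 k := Nat.pos_of_ne_zero hne
    have hik : i ≠ k := by rintro rfl; exact hne hi2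
    have hkj : ¬ M.Reach 2 k j := by
      intro hkj
      refine hs i hi k (hRlt k hk) j hj hk hkj (.inr (.inr (.inr ⟨hik, hi2, hRe k hk, hji⟩)))
    have hlow : ∀ l < n, M.raised l = 0 → ¬ M.Reach 2 l j := fun l hl hl0 hlj =>
      hkj (ReflTransGen.head (h.edge_two hpos hl hl0) hlj)
    have hrj : M.raised j = 1 := by
      have h1 := h.raised_le j hj
      have h2 : M.raised j ≠ 0 := fun h0 => hlow j hj h0 ReflTransGen.refl
      omega
    have h1 := h.le_num_two hs hb hj hrj hlow
    have h2 : M.earn j = M.num 1 j + 2 * M.num 2 j := rfl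
    omega
  set S := {v ∈ range n | M.Reach 1 i v} with hS
  have hmS : ∀ v, v ∈ S ↔ M.Reach 1 i v := fun v => by
    simpa [hS] using fun hv => hRlt v hv
  have hiS : i ∈ S := (hmS i).2 ReflTransGen.refl
  have hn1 : ∀ v ∈ S, M.num 1 v = M.earn v := fun v hv => by
    simp [earn, hR2 v ((hmS v).1 hv)]
  -- Price-1 chores held in `S` are accepted at that price only inside `S`, so `spread` places them
  -- all there. Each member holds at least `earn i - 1` of them and `i` holds one more, which bounds
  -- the average by `N`.
  have hMN : M.earn i ≤ N := by
    obtain ⟨z, hz1, hz2⟩ := hb.spread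
    have h1 : ∑ s ∈ S, M.num 1 s = #{e ∈ range m | M.price e = 1 ∧ M.owner e ∈ S} :=
      sum_card_fiber S (fun e => M.price e = 1) M.owner
    have h2 : #{e ∈ range m | M.price e = 1 ∧ M.owner e ∈ S} ≤
        #{e ∈ range m | M.price e = 1 ∧ z e ∈ S} := by
      refine card_le_card fun e => ?_
      simp only [mem_filter, mem_range, hmS]
      rintro ⟨he, h3, h4⟩
      obtain ⟨h5, h6⟩ := hz1 e he h3
      exact ⟨he, h3, ReflTransGen.tail h4 ⟨h5, e, he, h3, rfl, h6⟩⟩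
    rw [← sum_card_fiber S (fun e => M.price e = 1) z, ← h1] at h2
    have h3 : ∑ s ∈ S, #{e ∈ range m | M.price e = 1 ∧ z e = s} ≤ ∑ s ∈ S, N :=
      sum_le_sum fun s hs' => hz2 s (hRlt s ((hmS s).1 hs'))
    have h4 : ∑ s ∈ S, M.earn i < ∑ s ∈ S, (M.num 1 s + 1) := by
      refine sum_lt_sum (fun s hs' => ?_) ⟨i, hiS, by omega⟩
      rw [hn1 s hs']
      exact hRe s ((hmS s).1 hs')
    have h5 := h2.trans h3
    rw [sum_add_distrib] at h4
    simp only [sum_const, smul_eq_mul, mul_one] at h4 h5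
    have h6 : #S * M.earn i < #S * (N + 1) := by rw [mul_add, mul_one]; omega
    have := Nat.lt_of_mul_lt_mul_left h6
    omega
  have hjlow : M.raised j = 1 → ∃ l < n, M.raised l = 0 ∧ M.Reach 2 l j := by
    intro hrj
    by_contra! hlow
    have h1 := h.le_num_two hs hb hj hrj hlow
    have h2 : M.earn j = M.num 1 j + 2 * M.num 2 j := rfl
    omega
  -- Agents without price-2 chores are covered by the choice of `i`. The others reach `j`, directly
  -- or through a weight-1 agent, so their load is at most `earn j + 2`.
  have hle : ∀ v < n, M.earn v ≤ M.earn i := by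
    intro v hv
    by_cases hv2 : M.num 2 v = 0
    · have := hmax v hv hv2
      simp only [earn, hv2, hi2]
      omega
    · have hreach : M.Reach 2 v j := by
        by_cases hrj : M.raised j = 0
        · exact ReflTransGen.single (h.edge_two (Nat.pos_of_ne_zero hv2) hj hrj)
        · have := h.raised_le j hj
          obtain ⟨l, hl, hl0, hlj⟩ := hjlow (by omega)
          exact ReflTransGen.head (h.edge_two (Nat.pos_of_ne_zero hv2) hl hl0) hlj
      have := hs v hv v hv j hj ReflTransGen.refl hreach
      unfold Improves at this
      omega
  have hlow : ∃ v < n, ¬ M.Reach 1 i v ∧ M.raised v = 0 := by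
    have hnj : ¬ M.Reach 1 i j := fun hr => by
      have := hRe j hr
      omega
    by_cases hrj : M.raised j = 0
    · exact ⟨j, hj, hnj, hrj⟩
    · have := h.raised_le j hj
      obtain ⟨l, hl, hl0, hlj⟩ := hjlow (by omega)
      refine ⟨l, hl, fun hr => ?_, hl0⟩
      have h1 := hlj.num_pos (by rintro rfl; exact hrj hl0)
      have h2 := hR2 l hr
      omega
  have hvalid := h.isRaise hM (fun v _ => hR0 v) (fun v _ => hR2 v)
    (fun v w hv hvw => ReflTransGen.tail hv hvw) hlow
  have hprice : ∀ e < m, M'.price e = 1 ↔ M.price e = 1 ∧ ¬ M.Reach 1 i (M.owner e) := by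
    intro e he
    by_cases hR : M.Reach 1 i (M.owner e)
    · simp [hM.price_of e he hR, hR]
    · simp [hM.price_of_not e he hR, hR]
  have hprice2 : ∀ e < m, M.price e = 2 → ¬ M.Reach 1 i (M.owner e) := by
    intro e he h2 hR
    have h3 : 0 < M.num 2 (M.owner e) := num_pos_iff.2 ⟨e, he, h2, rfl⟩
    have := hR2 _ hR
    omega
  have hnumR : ∀ v, M.Reach 1 i v → M'.num 1 v = 0 ∧ M'.num 2 v = M.num 1 v := by
    intro v hv
    refine ⟨?_, ?_⟩
    · exact hvalid.num_one_of_raised (hM.raised_of v (hRlt v hv) hv) (hRlt v hv)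
    · unfold num
      congr 1
      ext e
      simp only [mem_filter, mem_range, hM.owner]
      refine and_congr_right fun he => ?_
      constructor
      · rintro ⟨-, rfl⟩
        refine ⟨(h.price_eq e he).resolve_right fun h2 => hprice2 e he h2 hv, rfl⟩
      · rintro ⟨-, rfl⟩
        exact ⟨hM.price_of e he hv, rfl⟩
  have hnum : ∀ v q, ¬ M.Reach 1 i v → M'.num q v = M.num q v := by
    intro v q hv
    unfold num
    congr 1
    ext e
    simp only [mem_filter, mem_range, hM.owner]
    refine and_congr_right fun he => ?_
    constructor <;> rintro ⟨h1, rfl⟩ <;> rw [hM.price_of_not e he hv] at * <;> exact ⟨h1, rfl⟩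
  -- The new bound is the common maximal load before raising: raised bundles at most double it, and
  -- all other loads stay below it or equal to it.
  refine ⟨hvalid, ⟨M.earn i, ?_, ?_, ?_, ?_⟩, ?_⟩
  · intro v hv
    have h1 := hle v hv
    by_cases hR : M.Reach 1 i v
    · obtain ⟨h2, h3⟩ := hnumR v hR
      have : M.num 1 v ≤ M.earn v := Nat.le_add_right _ _
      simp only [earn, h2, h3] at *
      omega
    · simp only [earn, hnum v _ hR] at *
      omega
  · intro v hv hpos
    have h1 := hle v hv
    by_cases hR : M.Reach 1 i v
    · obtain ⟨h2, h3⟩ := hnumR v hR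
      omega
    · simp only [earn, hnum v _ hR] at *
      omega
  · obtain ⟨z, hz⟩ := hb.supply
    -- Newly raised agents are supplied with their own chores. The old supply consists of price-2
    -- chores, none of which they held, so both assignments coexist.
    refine ⟨fun e => if M.Reach 1 i (M.owner e) then M.owner e else z e, fun u hu hru => ?_⟩
    by_cases hR : M.Reach 1 i u
    · have h1 := hRe u hR
      rw [← hn1 u ((hmS u).2 hR)] at h1
      refine h1.trans (Nat.add_le_add_right (card_le_card fun e => ?_) 1)
      simp only [mem_filter, mem_range]
      rintro ⟨he, hp, rfl⟩
      refine ⟨he, ⟨hM.price_of e he hR, ?_⟩, if_pos hR⟩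
      have := hvalid.owner_price e he
      rw [hM.owner, hM.price_of e he hR] at this
      exact this
    · rw [hM.raised_of_not u hu hR] at hru
      refine hMN.trans ((hz u hu hru).trans (Nat.add_le_add_right (card_le_card fun e => ?_) 1))
      simp only [mem_filter, mem_range]
      rintro ⟨he, ⟨hp, hacc⟩, hze⟩
      have hR' := hprice2 e he hp
      rw [hM.price_of_not e he hR', hM.raised_of_not u hu hR, hM.cost, if_neg hR']
      exact ⟨he, ⟨hp, hacc⟩, hze⟩
  · refine ⟨M'.owner, fun e he hp => ⟨hvalid.owner_lt e he, ?_⟩, fun v hv => ?_⟩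
    · rw [hvalid.owner_price e he, hp]
    · by_cases hR : M.Reach 1 i v
      · exact (hnumR v hR).1.trans_le (Nat.zero_le _)
      · have h1 := hle v hv
        have h2 : M'.num 1 v = M.num 1 v := hnum v 1 hR
        unfold earn num at *
        omega
  · have h1 : #{v ∈ range n | M'.raised v = 0} < #{v ∈ range n | M.raised v = 0} := by
      refine card_lt_card (ssubset_iff_of_subset ?_ |>.2 ⟨i, by simp [hi, hri], ?_⟩)
      · intro v
        simp only [mem_filter, mem_range]
        rintro ⟨hv, hv0⟩
        refine ⟨hv, ?_⟩
        by_cases hR : M.Reach 1 i v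
        · exact hR0 v hR
        · rwa [hM.raised_of_not v hv hR] at hv0
      · simp [hM.raised_of i hi ReflTransGen.refl]
    have h2 := Nat.mul_le_mul_right (potentialBound m) (Nat.succ_le_of_lt h1)
    rw [Nat.succ_mul] at h2
    have h3 := M'.potential_lt
    unfold rank
    omega

/-- The number of chores bounds everything as long as nobody is raised. -/
theorem Valid.bounded_init (h : M.Valid) (h0 : ∀ v < n, M.raised v = 0) : M.Bounded (2 * m + 1) := by
  have hle : ∀ v q, M.num q v ≤ m := fun v q => by
    simpa [num] using card_filter_le (range m) (fun e => M.price e = q ∧ M.owner e = v)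
  refine ⟨fun v _ => ?_, fun v _ _ => ?_, ⟨M.owner, fun u hu hr => ?_⟩,
    ⟨M.owner, fun e he hp => ⟨h.owner_lt e he, ?_⟩, fun v _ => ?_⟩⟩
  · have := hle v 1; have := hle v 2; unfold earn; omega
  · have := hle v 1; have := hle v 2; unfold earn; omega
  · simp [h0 u hu] at hr
  · rw [h.owner_price e he, hp]
  · have := hle v 1; unfold num at this; omega

end Market
end Chores

/-! ### Equilibria yield EFX and Pareto optimal allocations. -/

namespace Chores

open Finset Relation

theorem Allocation.sum_bundles {n m : ℕ} (Y : Allocation n m) (f : Fin m → ℝ) :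
    ∑ i, ∑ e ∈ Y.bundle i, f e = ∑ e, f e := by
  rw [← sum_biUnion fun i _ j _ hij => Y.disjoint i j hij]
  congr 1
  ext e
  simpa using Y.cover e

namespace Market

variable {n m : ℕ} {M : Market n m}

/-- The allocation given by the owners of the chores. -/
def Valid.allocation (h : M.Valid) : Allocation n m where
  bundle i := {e | M.owner e = i}
  disjoint i j hij := by
    rw [disjoint_filter]
    intro e _ h1 h2
    exact hij (Fin.ext (h1.symm.trans h2))
  cover e := ⟨⟨M.owner e, h.owner_lt e e.2⟩, by simp⟩

theorem Valid.mem_allocation (h : M.Valid) {e : Fin m} {i : Fin n} :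
    e ∈ h.allocation.bundle i ↔ M.owner e = i := by
  simp [Valid.allocation]

variable {I : Instance n m}

theorem Valid.bundleCost_allocation (h : M.Valid) (hc : ∀ i e, I.cost i e = M.cost i e)
    (i j : Fin n) : I.bundleCost i (h.allocation.bundle j) = M.bundleCost i j := by
  unfold Instance.bundleCost bundleCost Valid.allocation
  rw [sum_filter, sum_filter, Finset.sum_range]
  push_cast
  exact sum_congr rfl fun e _ => by rw [hc]

theorem Valid.isEFX (h : M.Valid) (hc : ∀ i e, I.cost i e = M.cost i e)
    (hs : M.Stuck) (ht : M.Settled) {N : ℕ} (hb : M.Bounded N) : IsEFX I h.allocation := by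
  refine fun i j => .inr fun e he => ?_
  have h1 := h.efx_price hs ht hb e.2 (h.mem_allocation.1 he) j.2
  have h2 := h.price_owner e.2
  rw [h.mem_allocation.1 he] at h2
  rw [h.earn_eq_bundleCost, h2, ← mul_add] at h1
  have h3 := Nat.le_of_mul_le_mul_left h1 (Nat.succ_pos _)
  have h4 : I.bundleCost i ((h.allocation.bundle i).erase e) + I.cost i e =
      I.bundleCost i (h.allocation.bundle i) := sum_erase_add _ _ he
  rw [h.bundleCost_allocation hc, hc] at h4
  rw [h.bundleCost_allocation hc]
  have h5 : (M.bundleCost i i : ℝ) ≤ M.bundleCost i j + M.cost i e := by exact_mod_cast h3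
  linarith

/-- The total price is a lower bound for the weighted total cost of every allocation and is attained
here, while a Pareto domination would lower that total since all weights are positive. -/
theorem Valid.isParetoOptimal (h : M.Valid) (hc : ∀ i e, I.cost i e = M.cost i e) :
    IsParetoOptimal I h.allocation := by
  rintro ⟨Y, hle, i₀, hlt⟩
  have h1 : ∑ i : Fin n, ((M.raised i : ℝ) + 1) * I.bundleCost i (Y.bundle i) <
      ∑ i : Fin n, ((M.raised i : ℝ) + 1) * I.bundleCost i (h.allocation.bundle i) :=
    sum_lt_sum (fun i _ => mul_le_mul_of_nonneg_left (hle i) (by positivity))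
      ⟨i₀, mem_univ _, mul_lt_mul_of_pos_left hlt (by positivity)⟩
  have h2 : ∑ e : Fin m, (M.price e : ℝ) ≤
      ∑ i : Fin n, ((M.raised i : ℝ) + 1) * I.bundleCost i (Y.bundle i) := by
    rw [← Y.sum_bundles]
    refine sum_le_sum fun i _ => ?_
    unfold Instance.bundleCost
    rw [mul_sum]
    refine sum_le_sum fun e _ => ?_
    rw [hc]
    exact_mod_cast h.price_le_weight e.2 i.2
  have h3 : ∑ i : Fin n, ((M.raised i : ℝ) + 1) * I.bundleCost i (h.allocation.bundle i) =
      ∑ e : Fin m, (M.price e : ℝ) := by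
    rw [← h.allocation.sum_bundles]
    refine sum_congr rfl fun i _ => ?_
    unfold Instance.bundleCost
    rw [mul_sum]
    refine sum_congr rfl fun e he => ?_
    rw [hc, h.price_owner e.2, h.mem_allocation.1 he]
    push_cast
    rfl
  linarith

end Market
end Chores

namespace RAM

/-! ### Reasoning about programs -/

@[simp] theorem State.setReg_reg (s : State) (x v y : ℕ) :
    (s.setReg x v).reg y = if y = x then v else s.reg y := by
  simp [State.setReg, Function.update_apply]

@[simp] theorem State.setReg_arr (s : State) (x v : ℕ) : (s.setReg x v).arr = s.arr := rfl

@[simp] theorem State.setArr_reg (s : State) (a k v : ℕ) : (s.setArr a k v).reg = s.reg := rfl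

@[simp] theorem State.setArr_arr (s : State) (a k v b : ℕ) :
    (s.setArr a k v).arr b = if b = a then Function.update (s.arr a) k v else s.arr b := by
  simp [State.setArr, Function.update_apply]

/-- The expression is true as a guard. -/
def Expr.Holds (s : State) (e : Expr) : Prop := e.eval s ≠ 0

/-- Negation of a guard. -/
def Expr.neg (e : Expr) : Expr := .sub (.const 1) e
/-- Conjunction of guards. -/
def Expr.conj (e f : Expr) : Expr := (Expr.add e.neg f.neg).neg
/-- Disjunction of guards. -/
def Expr.disj (e f : Expr) : Expr := .add e f
/-- The guard `e < f`. -/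
def Expr.lt (e f : Expr) : Expr := .sub f e
/-- The guard `e ≠ f`. -/
def Expr.ne (e f : Expr) : Expr := .add (.sub e f) (.sub f e)
/-- The guard `e = f`. -/
def Expr.eq (e f : Expr) : Expr := (Expr.ne e f).neg

section Holds

variable {s : State} {e f : Expr}

@[simp] theorem Expr.holds_reg {x : ℕ} : (Expr.reg x).Holds s ↔ s.reg x ≠ 0 := Iff.rfl

@[simp] theorem Expr.holds_read {a : ℕ} : (Expr.read a e).Holds s ↔ s.arr a (e.eval s) ≠ 0 := Iff.rfl

@[simp] theorem Expr.holds_neg : e.neg.Holds s ↔ ¬ e.Holds s := by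
  simp only [Holds, neg, eval]
  omega

@[simp] theorem Expr.holds_conj : (e.conj f).Holds s ↔ e.Holds s ∧ f.Holds s := by
  simp only [conj, holds_neg]
  simp only [Holds, neg, eval]
  omega

@[simp] theorem Expr.holds_disj : (e.disj f).Holds s ↔ e.Holds s ∨ f.Holds s := by
  simp only [Holds, disj, eval]
  omega

@[simp] theorem Expr.holds_lt : (e.lt f).Holds s ↔ e.eval s < f.eval s := by
  simp only [Holds, lt, eval]
  omega

@[simp] theorem Expr.holds_ne : (e.ne f).Holds s ↔ e.eval s ≠ f.eval s := by
  simp only [Holds, ne, eval]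
  omega

@[simp] theorem Expr.holds_eq : (e.eq f).Holds s ↔ e.eval s = f.eval s := by
  simp [eq]

end Holds

/-- The program does not assign to the register `x`. -/
def Program.KeepsReg (x : ℕ) : Program → Prop
  | .skip => True
  | .assign y _ => x ≠ y
  | .write _ _ _ => True
  | .seq p q => p.KeepsReg x ∧ q.KeepsReg x
  | .branch _ p q => p.KeepsReg x ∧ q.KeepsReg x
  | .loop _ p => p.KeepsReg x

/-- The program does not write to the array `a`. -/
def Program.KeepsArr (a : ℕ) : Program → Prop
  | .skip => True
  | .assign _ _ => True
  | .write b _ _ => a ≠ b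
  | .seq p q => p.KeepsArr a ∧ q.KeepsArr a
  | .branch _ p q => p.KeepsArr a ∧ q.KeepsArr a
  | .loop _ p => p.KeepsArr a

/-- The states agree on all registers and arrays that `p` does not touch. -/
structure Agree (p : Program) (s s' : State) : Prop where
  reg : ∀ x, p.KeepsReg x → s'.reg x = s.reg x
  arr : ∀ a, p.KeepsArr a → s'.arr a = s.arr a

theorem Agree.refl (p : Program) (s : State) : Agree p s s := ⟨fun _ _ => rfl, fun _ _ => rfl⟩

theorem Agree.trans {p : Program} {s s' s'' : State} (h : Agree p s s') (h' : Agree p s' s'') :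
    Agree p s s'' :=
  ⟨fun x hx => (h'.reg x hx).trans (h.reg x hx), fun a ha => (h'.arr a ha).trans (h.arr a ha)⟩

theorem Agree.weaken {p q : Program} {s s' : State} (h : Agree p s s')
    (h1 : ∀ x, q.KeepsReg x → p.KeepsReg x) (h2 : ∀ a, q.KeepsArr a → p.KeepsArr a) :
    Agree q s s' :=
  ⟨fun x hx => h.reg x (h1 x hx), fun a ha => h.arr a (h2 a ha)⟩

/-- The frame rule: through `Runs.mono` it makes untouched memory available after every subprogram,
so postconditions need only mention what changes. -/
theorem Exec.agree {p : Program} {s s' : State} {t : ℕ} (h : Exec p s t s') : Agree p s s' := by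
  induction h with
  | skip s => exact Agree.refl _ _
  | assign x e s => exact ⟨fun y (hy : y ≠ x) => by simp [hy], fun _ _ => rfl⟩
  | write a i e s => exact ⟨fun _ _ => rfl, fun b (hb : b ≠ a) => by simp [hb]⟩
  | seq _ _ ih1 ih2 =>
    exact Agree.trans (ih1.weaken (fun _ h => And.left h) fun _ h => And.left h)
      (ih2.weaken (fun _ h => And.right h) fun _ h => And.right h)
  | branch_true _ _ ih => exact ih.weaken (fun _ h => h.1) fun _ h => h.1
  | branch_false _ _ ih => exact ih.weaken (fun _ h => h.2) fun _ h => h.2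
  | loop_true _ _ _ ih1 ih2 => exact Agree.trans (ih1.weaken (fun _ h => h) fun _ h => h) ih2
  | loop_false _ => exact Agree.refl _ _

/-- A bound of the running time when every loop is repeated at most `L` times. -/
def Program.bound (L : ℕ) : Program → ℕ
  | .skip => 1
  | .assign _ e => e.size + 1
  | .write _ i e => i.size + e.size + 1
  | .seq p q => p.bound L + q.bound L
  | .branch g p q => g.size + 1 + p.bound L + q.bound L
  | .loop g p => (L + 1) * (g.size + 1 + p.bound L)

/-- For a fixed program the nesting depth is constant, so a polynomial limit on each loop's
iterations gives a polynomial running time. -/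
theorem Program.exists_bound_eq_eval (p : Program) :
    ∃ q : Polynomial ℕ, ∀ L, p.bound L = q.eval L := by
  induction p with
  | skip => exact ⟨1, fun L => by simp [bound]⟩
  | assign x e => exact ⟨Polynomial.C (e.size + 1), fun L => by simp [bound]⟩
  | write a i e => exact ⟨Polynomial.C (i.size + e.size + 1), fun L => by simp [bound]⟩
  | seq p q ihp ihq =>
    obtain ⟨f, hf⟩ := ihp
    obtain ⟨g, hg⟩ := ihq
    exact ⟨f + g, fun L => by simp [bound, hf, hg]⟩
  | branch e p q ihp ihq =>
    obtain ⟨f, hf⟩ := ihp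
    obtain ⟨g, hg⟩ := ihq
    exact ⟨Polynomial.C (e.size + 1) + f + g, fun L => by
      rw [Polynomial.eval_add, Polynomial.eval_add, Polynomial.eval_C]; simp [bound, hf, hg]⟩
  | loop e p ihp =>
    obtain ⟨f, hf⟩ := ihp
    exact ⟨(Polynomial.X + 1) * (Polynomial.C (e.size + 1) + f), fun L => by
      rw [Polynomial.eval_mul, Polynomial.eval_add, Polynomial.eval_add, Polynomial.eval_C]
      simp [bound, hf]⟩

/-- Started in `s`, the program halts within its time bound in a state that satisfies `Q`. -/
def Runs (L : ℕ) (p : Program) (s : State) (Q : State → Prop) : Prop :=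
  ∃ t s', Exec p s t s' ∧ t ≤ p.bound L ∧ Q s'

section Runs

variable {L : ℕ} {p q : Program} {s : State} {Q Q' : State → Prop}

theorem Runs.mono (h : Runs L p s Q) (hQ : ∀ s', Agree p s s' → Q s' → Q' s') : Runs L p s Q' := by
  obtain ⟨t, s', h1, h2, h3⟩ := h
  exact ⟨t, s', h1, h2, hQ s' h1.agree h3⟩

theorem Runs.skip (h : Q s) : Runs L .skip s Q := ⟨_, _, .skip s, le_rfl, h⟩

theorem Runs.assign {x : ℕ} {e : Expr} (h : Q (s.setReg x (e.eval s))) :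
    Runs L (.assign x e) s Q := ⟨_, _, .assign x e s, le_rfl, h⟩

theorem Runs.write {a : ℕ} {i e : Expr} (h : Q (s.setArr a (i.eval s) (e.eval s))) :
    Runs L (.write a i e) s Q := ⟨_, _, .write a i e s, le_rfl, h⟩

theorem Runs.seq (h : Runs L p s fun s' => Runs L q s' Q) : Runs L (.seq p q) s Q := by
  obtain ⟨t, s', h1, h2, t', s'', h3, h4, h5⟩ := h
  exact ⟨_, _, .seq h1 h3, Nat.add_le_add h2 h4, h5⟩

theorem Runs.branch {g : Expr} (h1 : g.Holds s → Runs L p s Q) (h2 : ¬ g.Holds s → Runs L q s Q) :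
    Runs L (.branch g p q) s Q := by
  by_cases hg : g.Holds s
  · obtain ⟨t, s', h3, h4, h5⟩ := h1 hg
    refine ⟨_, _, .branch_true hg h3, ?_, h5⟩
    simp only [Program.bound]
    omega
  · obtain ⟨t, s', h3, h4, h5⟩ := h2 hg
    refine ⟨_, _, .branch_false (not_not.1 hg) h3, ?_, h5⟩
    simp only [Program.bound]
    omega

/-- The measure drops with every iteration, so its initial value bounds their number. Agreement with
the initial state is carried along and need not be part of the invariant. -/
theorem Runs.loop {g : Expr} (I : State → Prop) (μ : State → ℕ) (h0 : I s) (hL : μ s ≤ L)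
    (hstep : ∀ s', Agree (.loop g p) s s' → I s' → g.Holds s' →
      Runs L p s' fun s'' => I s'' ∧ μ s'' < μ s') :
    Runs L (.loop g p) s fun s' => I s' ∧ ¬ g.Holds s' := by
  suffices ∀ k s', Agree (.loop g p) s s' → I s' → μ s' ≤ k → ∃ t s'', Exec (.loop g p) s' t s'' ∧
      t ≤ (k + 1) * (g.size + 1 + p.bound L) ∧ I s'' ∧ ¬ g.Holds s'' by
    obtain ⟨t, s', h1, h2, h3⟩ := this (μ s) s (Agree.refl _ _) h0 le_rfl
    exact ⟨t, s', h1, h2.trans (Nat.mul_le_mul_right _ (by omega)), h3⟩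
  intro k
  induction k with
  | zero =>
    intro s' hA hI hk
    by_cases hg : g.Holds s'
    · obtain ⟨t, s'', -, -, -, h4⟩ := hstep s' hA hI hg
      omega
    · exact ⟨_, _, .loop_false (not_not.1 hg), by omega, hI, hg⟩
  | succ k ih =>
    intro s' hA hI hk
    by_cases hg : g.Holds s'
    · obtain ⟨t, s'', h1, h2, h3, h4⟩ := hstep s' hA hI hg
      obtain ⟨t', s₃, h5, h6, h7⟩ := ih s''
        (hA.trans (h1.agree.weaken (fun _ h => h) fun _ h => h)) h3 (by omega)
      refine ⟨_, _, .loop_true hg h1 h5, ?_, h7⟩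
      rw [Nat.succ_mul]
      omega
    · refine ⟨_, _, .loop_false (not_not.1 hg), ?_, hI, hg⟩
      rw [Nat.succ_mul]
      omega

/-- Run `p` for all values of the register `x` below the value of the register `y`. -/
def Program.forLt (x y : ℕ) (p : Program) : Program :=
  .seq (.assign x (.const 0))
    (.loop (.sub (.reg y) (.reg x)) (.seq p (.assign x (.add (.reg x) (.const 1)))))

@[simp] theorem Program.keepsReg_forLt {x y z : ℕ} :
    (Program.forLt x y p).KeepsReg z ↔ z ≠ x ∧ p.KeepsReg z := by
  simp [forLt, KeepsReg]
  tauto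

@[simp] theorem Program.keepsArr_forLt {x y a : ℕ} :
    (Program.forLt x y p).KeepsArr a ↔ p.KeepsArr a := by
  simp [forLt, KeepsArr]

theorem Runs.forLt {x y : ℕ} (I : ℕ → State → Prop) (hxy : y ≠ x) (hx : p.KeepsReg x)
    (hy : p.KeepsReg y) (hL : s.reg y ≤ L) (hI : ∀ k s v, I k s → I k (s.setReg x v)) (h0 : I 0 s)
    (hstep : ∀ k < s.reg y, ∀ s', Agree (.forLt x y p) s s' → s'.reg x = k → I k s' →
      Runs L p s' (I (k + 1))) :
    Runs L (.forLt x y p) s (I (s.reg y)) := by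
  refine Runs.seq (Runs.assign ?_)
  have hA0 : Agree (.forLt x y p) s (s.setReg x 0) :=
    ⟨fun z hz => by simp [(Program.keepsReg_forLt.1 hz).1], fun a _ => rfl⟩
  refine (Runs.loop (fun s' => I (s'.reg x) s' ∧ s'.reg x ≤ s'.reg y ∧ s'.reg y = s.reg y ∧
    Agree (.forLt x y p) s s') (fun s' => s'.reg y - s'.reg x) ?_ ?_ ?_).mono ?_
  · exact ⟨by simpa [Expr.eval] using hI _ _ 0 h0, by simp [Expr.eval], by simp [hxy], hA0⟩
  · simpa [hxy] using hL.trans' (Nat.sub_le _ _)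
  · rintro s' - ⟨h1, h2, h3, h4⟩ hg
    have hlt : s'.reg x < s'.reg y := by
      simp only [Expr.Holds, Expr.eval] at hg
      omega
    refine Runs.seq ((hstep _ (h3 ▸ hlt) s' h4 rfl h1).mono ?_)
    intro s'' hA'' h5
    refine Runs.assign ?_
    have e1 := hA''.reg x hx
    have e2 := hA''.reg y hy
    simp only [Expr.eval, State.setReg_reg, if_true, hxy, if_false, e1, e2]
    refine ⟨⟨hI _ _ _ h5, by omega, h3, h4.trans (Agree.trans (hA''.weaken (fun z hz =>
      (Program.keepsReg_forLt.1 hz).2) (fun a ha => Program.keepsArr_forLt.1 ha)) ?_)⟩, by omega⟩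
    exact ⟨fun z hz => by simp [(Program.keepsReg_forLt.1 hz).1], fun a _ => rfl⟩
  · rintro s' - ⟨⟨h1, h2, h3, -⟩, hg⟩
    have : s'.reg x = s.reg y := by
      simp only [Expr.Holds, Expr.eval] at hg
      omega
    rwa [this] at h1

end Runs

end RAM

/-! ### Computing reachability by marking. -/

namespace Chores

open Finset Relation

namespace Market

variable {n m : ℕ} {M : Market n m} {q x : ℕ} {vis via : ℕ → ℕ}

/-- The marks `vis` increase along the edges, recorded in `via`, by which agents were found. -/
structure Tree (M : Market n m) (q x : ℕ) (vis via : ℕ → ℕ) : Prop where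
  root_lt : x < n
  root : vis x ≠ 0
  node : ∀ v < n, vis v ≠ 0 → v ≠ x → via v < m ∧ M.price (via v) = q ∧
    M.raised v + M.cost v (via v) = q ∧ vis (M.owner (via v)) ≠ 0 ∧ vis (M.owner (via v)) < vis v

/-- No edge leads from a marked agent to an unmarked one. -/
def Closed (M : Market n m) (q : ℕ) (vis : ℕ → ℕ) : Prop :=
  ∀ e < m, ∀ v < n, M.price e = q → vis (M.owner e) ≠ 0 → M.raised v + M.cost v e = q → vis v ≠ 0

/-- Parents have strictly smaller marks, so following them terminates at the root; conversely,
closedness propagates marks along any path. -/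
theorem Tree.reach_iff (h : M.Tree q x vis via) (hM : M.Valid) (hc : M.Closed q vis) {v : ℕ}
    (hv : v < n) : vis v ≠ 0 ↔ M.Reach q x v := by
  constructor
  · intro h0
    induction hk : vis v using Nat.strong_induction_on generalizing v with
    | _ k ih =>
      by_cases hvx : v = x
      · subst hvx; exact ReflTransGen.refl
      · obtain ⟨h1, h2, h3, h4, h5⟩ := h.node v hv h0 hvx
        exact (ih _ (hk ▸ h5) (hM.owner_lt _ h1) h4 rfl).tail ⟨hv, _, h1, h2, rfl, h3⟩
  · intro hr
    clear hv
    induction hr with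
    | refl => exact h.root
    | tail _ hbc ih =>
      obtain ⟨hv, e, he, h1, rfl, h3⟩ := hbc
      exact hc e he _ hv h1 ih h3

/-- The state of a search for the agents reachable from `x`, with `k` agents found. -/
structure Search (M : Market n m) (q x k : ℕ) (vis via : ℕ → ℕ) : Prop where
  tree : M.Tree q x vis via
  le : ∀ v < n, vis v ≤ k
  card : k + #{v ∈ range n | vis v = 0} = n

theorem card_unmarked_update {v k : ℕ} (hv : v < n) (h0 : vis v = 0) (hk : k ≠ 0) :
    #{w ∈ range n | Function.update vis v k w = 0} + 1 = #{w ∈ range n | vis w = 0} := by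
  have : {w ∈ range n | vis w = 0} =
      insert v {w ∈ range n | Function.update vis v k w = 0} := by
    ext w
    by_cases hw : w = v
    · subst hw; simp [hv, h0]
    · simp [hw]
  rw [this, card_insert_of_notMem (by simp [hk])]

theorem Search.insert {k e v : ℕ} (h : M.Search q x k vis via) (hM : M.Valid) (he : e < m)
    (hv : v < n) (h1 : M.price e = q) (h2 : vis (M.owner e) ≠ 0) (h3 : vis v = 0)
    (h4 : M.raised v + M.cost v e = q) :
    M.Search q x (k + 1) (Function.update vis v (k + 1)) (Function.update via v e) where
  tree := by
    have hvx : v ≠ x := by rintro rfl; exact h.tree.root h3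
    refine ⟨h.tree.root_lt, by simpa [hvx.symm] using h.tree.root, fun w hw hw0 hwx => ?_⟩
    by_cases hwv : w = v
    · subst hwv
      have hne : M.owner e ≠ w := by rintro rfl; exact h2 h3
      -- The fresh mark `k + 1` exceeds all existing ones, so the new parent edge is increasing.
      have := h.le _ (hM.owner_lt e he)
      simp only [Function.update_self, Function.update_of_ne hne]
      exact ⟨he, h1, h4, h2, by omega⟩
    · simp only [Function.update_of_ne hwv] at hw0 ⊢
      obtain ⟨g1, g2, g3, g4, g5⟩ := h.tree.node w hw hw0 hwx
      have hne : M.owner (via w) ≠ v := fun hne => g4 (hne ▸ h3)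
      rw [Function.update_of_ne hne]
      exact ⟨g1, g2, g3, g4, g5⟩
  le w hw := by
    by_cases hwv : w = v
    · subst hwv; simp
    · rw [Function.update_of_ne hwv]; exact (h.le w hw).trans (Nat.le_succ _)
  card := by
    have h5 := h.card
    have h6 := card_unmarked_update (vis := vis) (k := k + 1) hv h3 (by omega)
    omega

theorem Search.init (hx : x < n) (h0 : ∀ v < n, vis v = 0) :
    M.Search q x 1 (Function.update vis x 1) via where
  tree := ⟨hx, by simp, fun v hv hv0 hvx => by simp [hvx, h0 v hv] at hv0⟩
  le v hv := by
    by_cases hvx : v = x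
    · subst hvx; simp
    · simp [hvx, h0 v hv]
  card := by
    have h1 := card_unmarked_update (vis := vis) (k := 1) hx (h0 x hx) (by omega)
    have h2 : {w ∈ range n | vis w = 0} = range n := by
      ext w
      simpa using h0 w
    rw [h2, card_range] at h1
    omega

end Market

open RAM

/-- The priced allocation in the memory: costs are read from the array `0` by means of the row
offsets in the array `2`; the arrays `1`, `3` and `4` hold the owners, the weights and the prices. -/
def marketOf (n m : ℕ) (s : State) : Market n m where
  cost i e := s.arr 0 (s.arr 2 i + e)
  raised := s.arr 3
  price := s.arr 4
  owner := s.arr 1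

theorem marketOf_congr {n m : ℕ} {s s' : State} (h : ∀ a < 5, s'.arr a = s.arr a) :
    marketOf n m s' = marketOf n m s := by
  simp [marketOf, h]

/-- The cost of the chore in register `e` to the agent in register `i`. -/
def costExpr (i e : ℕ) : Expr := .read 0 (.add (.read 2 (.reg i)) (.reg e))

/-- The agent in register `v` accepts the chore in register `e` at price `q`. -/
def acceptExpr (v e q : ℕ) : Expr :=
  .eq (.add (.read 3 (.reg v)) (costExpr v e)) (.const q)

/-- Inspect the edge given by the chore in register `12` and the agent in register `13`. -/
def inspectProg (q vis via : ℕ) : Program :=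
  .branch (.conj (.conj (.eq (.read 4 (.reg 12)) (.const q)) (.read vis (.read 1 (.reg 12))))
      (.conj (.neg (.read vis (.reg 13))) (acceptExpr 13 12 q)))
    (.seq (.assign 10 (.add (.reg 10) (.const 1)))
      (.seq (.write vis (.reg 13) (.reg 10))
        (.seq (.write via (.reg 13) (.reg 12)) (.assign 11 (.const 1)))))
    .skip

/-- Search for all agents reachable from the agent in register `x` at price `q`. -/
def searchProg (q x vis via : ℕ) : Program :=
  .seq (.forLt 13 0 (.write vis (.reg 13) (.const 0)))
    (.seq (.write vis (.reg x) (.const 1))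
      (.seq (.assign 10 (.const 1))
        (.seq (.assign 11 (.const 1))
          (.loop (.reg 11)
            (.seq (.assign 11 (.const 0)) (.forLt 12 1 (.forLt 13 0 (inspectProg q vis via))))))))

theorem keepsReg_inspectProg {q vis via z : ℕ} (h10 : z ≠ 10) (h11 : z ≠ 11) :
    (inspectProg q vis via).KeepsReg z := by
  simp [inspectProg, Program.KeepsReg, h10, h11]

theorem keepsArr_inspectProg {q vis via a : ℕ} (h1 : a ≠ vis) (h2 : a ≠ via) :
    (inspectProg q vis via).KeepsArr a := by
  simp [inspectProg, Program.KeepsArr, h1, h2]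

theorem keepsReg_searchProg {q x vis via z : ℕ} (h10 : z ≠ 10) (h11 : z ≠ 11) (h12 : z ≠ 12)
    (h13 : z ≠ 13) : (searchProg q x vis via).KeepsReg z := by
  simp [searchProg, Program.KeepsReg, h10, h11, h12, h13, keepsReg_inspectProg]

theorem keepsArr_searchProg {q x vis via a : ℕ} (h1 : a ≠ vis) (h2 : a ≠ via) :
    (searchProg q x vis via).KeepsArr a := by
  simp [searchProg, Program.KeepsArr, h1, h2, keepsArr_inspectProg]

/-- A search in progress, after inspection of the edges given by chores below `e`, and by the chore
`e` and agents below `v`, in a round that started with at most `U` unmarked agents. -/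
def SearchInv {n m : ℕ} (M : Market n m) (q x vis via U e v : ℕ) (s : State) : Prop :=
  M.Search q x (s.reg 10) (s.arr vis) (s.arr via) ∧ s.reg 11 ≤ 1 ∧
    #{w ∈ range n | s.arr vis w = 0} + s.reg 11 ≤ U ∧
    (s.reg 11 = 0 → ∀ f < m, ∀ w < n, (f < e ∨ (f = e ∧ w < v)) → M.price f = q →
      s.arr vis (M.owner f) ≠ 0 → M.raised w + M.cost w f = q → s.arr vis w ≠ 0)

theorem SearchInv.setReg {n m : ℕ} {M : Market n m} {q x vis via U e v z k : ℕ} {s : State}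
    (h : SearchInv M q x vis via U e v s) (h10 : z ≠ 10) (h11 : z ≠ 11) :
    SearchInv M q x vis via U e v (s.setReg z k) := by
  have e10 : (s.setReg z k).reg 10 = s.reg 10 := by simp [h10.symm]
  have e11 : (s.setReg z k).reg 11 = s.reg 11 := by simp [h11.symm]
  unfold SearchInv
  rw [e10, e11]
  exact h

variable {n m L : ℕ} {s : State}

theorem runs_inspectProg {q x vis via U e v : ℕ} (hM : (marketOf n m s).Valid)
    (hne : vis ≠ via) (he : e < m) (hv : v < n) (hre : s.reg 12 = e) (hrv : s.reg 13 = v)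
    (h : SearchInv (marketOf n m s) q x vis via U e v s) :
    Runs L (inspectProg q vis via) s (SearchInv (marketOf n m s) q x vis via U e (v + 1)) := by
  obtain ⟨h1, h2, h3, h4⟩ := h
  refine Runs.branch (fun hg => ?_) (fun hg => Runs.skip ?_)
  · simp only [Expr.holds_conj, Expr.holds_neg, Expr.holds_eq, acceptExpr, costExpr, Expr.holds_read,
      Expr.eval, hre, hrv, not_not] at hg
    obtain ⟨⟨g1, g2⟩, g3, g4⟩ := hg
    refine Runs.seq (Runs.assign (Runs.seq (Runs.write (Runs.seq (Runs.write (Runs.assign ?_))))))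
    have h5 := h1.insert hM he hv g1 g2 g3 g4
    have h6 := Market.card_unmarked_update (vis := s.arr vis) (k := s.reg 10 + 1) hv g3 (by omega)
    simp only [SearchInv, Expr.eval, State.setReg_reg, State.setReg_arr, State.setArr_reg,
      State.setArr_arr, if_true, hne, hne.symm, if_false, hre, hrv,
      Nat.reduceEqDiff]
    exact ⟨h5, le_rfl, by omega, by simp⟩
  · refine ⟨h1, h2, h3, fun h0 f hf w hw hlt g1 g2 g4 => ?_⟩
    by_cases hfw : f = e ∧ w = v
    · obtain ⟨rfl, rfl⟩ := hfw
      intro g3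
      apply hg
      simp only [Expr.holds_conj, Expr.holds_neg, Expr.holds_eq, acceptExpr, costExpr, Expr.holds_read,
        Expr.eval, hre, hrv, not_not]
      exact ⟨⟨g1, g2⟩, g3, g4⟩
    · exact h4 h0 f hf w hw (by omega) g1 g2 g4

theorem runs_searchProg {q x vis via : ℕ} (hnL : n < L) (hmL : m ≤ L) (h0 : s.reg 0 = n)
    (h1 : s.reg 1 = m) (hM : (marketOf n m s).Valid) (hx : s.reg x < n) (hx' : 13 < x)
    (hvis : 5 ≤ vis) (hvia : 5 ≤ via) (hne : vis ≠ via) :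
    Runs L (searchProg q x vis via) s fun s' =>
      (marketOf n m s).Tree q (s.reg x) (s'.arr vis) (s'.arr via) ∧
        (∀ v < n, s'.arr vis v ≤ n) ∧ (marketOf n m s).Closed q (s'.arr vis) := by
  set M := marketOf n m s with hMdef
  have hsub : ∀ {p : Program} {s₁ s₂}, Agree p s₁ s₂ →
      (∀ z, z ≠ 10 → z ≠ 11 → z ≠ 12 → z ≠ 13 → p.KeepsReg z) →
      (∀ a, a ≠ vis → a ≠ via → p.KeepsArr a) →
      s₂.reg 0 = s₁.reg 0 ∧ s₂.reg 1 = s₁.reg 1 ∧ s₂.reg x = s₁.reg x ∧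
        marketOf n m s₂ = marketOf n m s₁ := by
    intro p s₁ s₂ hA hr ha
    exact ⟨hA.reg 0 (hr 0 (by omega) (by omega) (by omega) (by omega)),
      hA.reg 1 (hr 1 (by omega) (by omega) (by omega) (by omega)),
      hA.reg x (hr x (by omega) (by omega) (by omega) (by omega)),
      marketOf_congr fun a ha' => hA.arr a (ha a (by omega) (by omega))⟩
  refine Runs.seq ((Runs.forLt (fun k s' => ∀ v < k, s'.arr vis v = 0) (by omega)
    (by simp [Program.KeepsReg]) (by simp [Program.KeepsReg]) (by omega) (fun _ _ _ h => h)
    (by simp) ?_).mono ?_)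
  · intro k _ s' _ hk hI
    refine Runs.write fun v hv => ?_
    simp only [State.setArr_arr, if_true, Expr.eval, hk]
    by_cases hvk : v = k
    · subst hvk; simp
    · rw [Function.update_of_ne hvk]; exact hI v (by omega)
  intro s₁ hA₁ hz
  obtain ⟨e0, e1, ex, eM⟩ := hsub hA₁ (fun z _ _ _ h13 => by simp [Program.KeepsReg, h13])
    (fun a ha _ => by simp [Program.KeepsArr, ha])
  rw [h0] at hz e0
  rw [h1] at e1
  refine Runs.seq (Runs.write (Runs.seq (Runs.assign (Runs.seq (Runs.assign ?_)))))
  set s₂ := (((s₁.setArr vis (Expr.eval s₁ (.reg x)) (Expr.eval s₁ (.const 1))).setReg 10 1).setReg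
    11 1) with hs₂
  have f0 : s₂.reg 0 = n := by simp [hs₂, e0]
  have f1 : s₂.reg 1 = m := by simp [hs₂, e1]
  have f10 : s₂.reg 10 = 1 := by simp [hs₂]
  have f11 : s₂.reg 11 = 1 := by simp [hs₂]
  have fM : marketOf n m s₂ = M := by
    rw [hMdef, ← eM]
    refine marketOf_congr fun a ha => ?_
    have : a ≠ vis := by omega
    simp [hs₂, this]
  have hS : M.Search q (s.reg x) (s₂.reg 10) (s₂.arr vis) (s₂.arr via) := by
    rw [f10]
    have := Market.Search.init (M := M) (q := q) (via := s₂.arr via) hx hz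
    simpa [hs₂, Expr.eval, ex] using this
  show Runs L _ s₂ _
  -- Register 11 signals a new mark in the last round; if it is 0, all edges were inspected without
  -- effect and the marks are closed. Adding it to the number of unmarked agents makes even the
  -- final, fruitless round decrease the measure.
  refine (Runs.loop (fun s' => M.Search q (s.reg x) (s'.reg 10) (s'.arr vis) (s'.arr via) ∧
    s'.reg 11 ≤ 1 ∧ (s'.reg 11 = 0 → M.Closed q (s'.arr vis)))
    (fun s' => #{v ∈ range n | s'.arr vis v = 0} + s'.reg 11)
    ⟨hS, f11.le, by simp [f11]⟩ ?_ ?_).mono ?_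
  · have := hS.card
    simp only [f10, f11] at this ⊢
    omega
  · rintro s₃ hA₃ ⟨g1, g2, g3⟩ hg
    have hgo : s₃.reg 11 = 1 := by
      simp only [Expr.Holds, Expr.eval] at hg
      omega
    obtain ⟨k0, k1, -, kM⟩ := hsub hA₃
      (fun z h10 h11 h12 h13 => by
        simp [Program.KeepsReg, h11, h12, h13, keepsReg_inspectProg, h10])
      (fun a ha ha' => by simp [Program.KeepsArr, ha, ha', keepsArr_inspectProg])
    rw [f0] at k0
    rw [f1] at k1
    rw [fM] at kM
    set U := #{w ∈ range n | s₃.arr vis w = 0} with hU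
    refine Runs.seq (Runs.assign ?_)
    set s₄ := s₃.setReg 11 (Expr.eval s₃ (.const 0)) with hs₄
    have l0 : s₄.reg 0 = n := by simp [hs₄, k0]
    have l1 : s₄.reg 1 = m := by simp [hs₄, k1]
    have lM : marketOf n m s₄ = M := kM
    refine (Runs.forLt (fun k s' => SearchInv M q (s.reg x) vis via U k 0 s') (by omega)
      (by simp [keepsReg_inspectProg]) (by simp [keepsReg_inspectProg]) (by omega)
      (fun k s' v h => h.setReg (by omega) (by omega)) ?_ ?_).mono ?_
    · refine ⟨?_, ?_, ?_, ?_⟩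
      · simpa [hs₄] using g1
      · simp [hs₄, Expr.eval]
      · simp [hs₄, Expr.eval, hU]
      · simp
    · intro e he s₅ hA₅ hr₅ hI₅
      rw [l1] at he
      obtain ⟨m0, m1, -, mM⟩ := hsub hA₅
        (fun z h10 h11 h12 h13 => by simp [h12, h13, keepsReg_inspectProg, h10, h11])
        (fun a ha ha' => by simp [ha, ha', keepsArr_inspectProg])
      rw [l0] at m0
      rw [lM] at mM
      refine (Runs.forLt (fun k s' => SearchInv M q (s.reg x) vis via U e k s') (by omega)
        (by simp [keepsReg_inspectProg]) (by simp [keepsReg_inspectProg]) (by omega)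
        (fun k s' v h => h.setReg (by omega) (by omega)) hI₅ ?_).mono ?_
      · intro v hv s₆ hA₆ hr₆ hI₆
        rw [m0] at hv
        obtain ⟨-, -, -, nM⟩ := hsub hA₆
          (fun z h10 h11 h12 h13 => by simp [h13, keepsReg_inspectProg, h10, h11])
          (fun a ha ha' => by simp [ha, ha', keepsArr_inspectProg])
        have hr12 : s₆.reg 12 = e := by
          rw [hA₆.reg 12 (by simp [keepsReg_inspectProg]), hr₅]
        have nM' := nM.trans mM
        have := runs_inspectProg (L := L) (s := s₆) (q := q) (x := s.reg x) (U := U)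
          (nM' ▸ hM) hne he hv hr12 hr₆ (nM' ▸ hI₆)
        rwa [nM'] at this
      · rintro s₆ - ⟨i1, i2, i3, i4⟩
        rw [m0] at i4
        exact ⟨i1, i2, i3, fun i0 f hf w hw hlt => i4 i0 f hf w hw (by omega)⟩
    · rintro s₅ - ⟨i1, i2, i3, i4⟩
      rw [l1] at i4
      refine ⟨⟨i1, i2, fun i0 f hf w hw => i4 i0 f hf w hw (.inl hf)⟩, by omega⟩
  · rintro s₃ - ⟨⟨g1, g2, g3⟩, hg⟩
    have hgo : s₃.reg 11 = 0 := by simpa [Expr.Holds, Expr.eval] using hg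
    have := g1.card
    exact ⟨g1.tree, fun v hv => (g1.le v hv).trans (by omega), g3 hgo⟩

end Chores

/-! ### Transfers along recorded paths, counting, and finding improving triples. -/

namespace Chores

open Finset Relation RAM

variable {n m L : ℕ} {s : State}

/-- Pass on chores along the recorded path from the agent in register `x` to the one in `y`. -/
def walkProg (x y via : ℕ) : Program :=
  .seq (.assign 14 (.reg y))
    (.loop (.ne (.reg 14) (.reg x))
      (.seq (.assign 15 (.read via (.reg 14)))
        (.seq (.assign 16 (.read 1 (.reg 15)))
          (.seq (.write 1 (.reg 15) (.reg 14)) (.assign 14 (.reg 16))))))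

theorem keepsReg_walkProg {x y via z : ℕ} (h14 : z ≠ 14) (h15 : z ≠ 15) (h16 : z ≠ 16) :
    (walkProg x y via).KeepsReg z := by
  simp [walkProg, Program.KeepsReg, h14, h15, h16]

theorem marketOf_setReg (s : State) (x v : ℕ) : marketOf n m (s.setReg x v) = marketOf n m s := rfl

theorem marketOf_setArr_one (s : State) (e v : ℕ) : marketOf n m (s.setArr 1 e v) =
    { marketOf n m s with owner := Function.update (marketOf n m s).owner e v } := by
  simp [marketOf]

theorem runs_walkProg {q x y via : ℕ} {vis : ℕ → ℕ} (hM : (marketOf n m s).Valid)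
    (ht : (marketOf n m s).Tree q (s.reg x) vis (s.arr via)) (hle : ∀ v < n, vis v ≤ L)
    (hy : s.reg y < n) (hy0 : vis (s.reg y) ≠ 0) (hx' : 16 < x) (hvia : 5 ≤ via) :
    Runs L (walkProg x y via) s fun s' =>
      Market.Shifted q (marketOf n m s) (marketOf n m s') (s.reg x) (s.reg y) := by
  set M := marketOf n m s with hMdef
  -- The path is walked from its end towards the root. Marks decrease on the way, so chores whose
  -- original owners have smaller marks than the current agent are still untouched; the current mark
  -- is also the measure.
  refine Runs.seq (Runs.assign ((Runs.loop (fun s' => s'.reg 14 < n ∧ vis (s'.reg 14) ≠ 0 ∧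
    s'.reg x = s.reg x ∧ s'.arr via = s.arr via ∧
    Market.Shifted q M (marketOf n m s') (s'.reg 14) (s.reg y) ∧
    ∀ e < m, vis (M.owner e) < vis (s'.reg 14) → s'.arr 1 e = M.owner e)
    (fun s' => vis (s'.reg 14)) ?_ ?_ ?_).mono ?_))
  · have hx : x ≠ 14 := by omega
    simp only [State.setReg_reg, State.setReg_arr, if_true, Expr.eval, hx, if_false,
      marketOf_setReg]
    exact ⟨hy, hy0, trivial, trivial, .refl hM, fun _ _ _ => rfl⟩
  · simpa [Expr.eval] using hle _ hy
  · rintro s' - ⟨h1, h2, h3, h4, h5, h6⟩ hg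
    simp only [Expr.holds_ne, Expr.eval, h3] at hg
    obtain ⟨g1, g2, g3, g4, g5⟩ := ht.node _ h1 h2 hg
    set e := s.arr via (s'.reg 14) with he
    have ho : s'.arr 1 e = M.owner e := h6 e g1 g5
    refine Runs.seq (Runs.assign (Runs.seq (Runs.assign (Runs.seq (Runs.write (Runs.assign ?_))))))
    have hx1 : x ≠ 14 := by omega
    have hx2 : x ≠ 15 := by omega
    have hx3 : x ≠ 16 := by omega
    have hv1 : via ≠ 1 := by omega
    simp only [marketOf_setReg, marketOf_setArr_one, Expr.eval, State.setReg_reg,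
      State.setReg_arr, State.setArr_reg, State.setArr_arr, if_true, hx1, hx2, hx3, hv1, if_false,
      h3, h4, ← he, ho, Nat.reduceEqDiff, true_and]
    refine ⟨⟨hM.owner_lt e g1, g4, ?_, ?_⟩, g5⟩
    · exact h5.step g1 g2 ho h1 g3
    · intro f hf hlt
      have hfe : f ≠ e := by rintro rfl; exact lt_irrefl _ hlt
      rw [Function.update_of_ne hfe]
      exact h6 f hf (hlt.trans g5)
  · rintro s' - ⟨⟨-, -, h3, -, h5, -⟩, hg⟩
    simp only [Expr.holds_ne, Expr.eval, not_not, h3] at hg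
    rwa [hg] at h5

/-- Count the chores of each price in every bundle. -/
def countProg : Program :=
  .seq (.forLt 17 0 (.seq (.write 5 (.reg 17) (.const 0)) (.write 6 (.reg 17) (.const 0))))
    (.forLt 18 1 (.branch (.eq (.read 4 (.reg 18)) (.const 1))
      (.write 5 (.read 1 (.reg 18)) (.add (.read 5 (.read 1 (.reg 18))) (.const 1)))
      (.write 6 (.read 1 (.reg 18)) (.add (.read 6 (.read 1 (.reg 18))) (.const 1)))))

theorem keepsReg_countProg {z : ℕ} (h17 : z ≠ 17) (h18 : z ≠ 18) : countProg.KeepsReg z := by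
  simp [countProg, Program.KeepsReg, h17, h18]

theorem keepsArr_countProg {a : ℕ} (h5 : a ≠ 5) (h6 : a ≠ 6) : countProg.KeepsArr a := by
  simp [countProg, Program.KeepsArr, h5, h6]

/-- The arrays `5` and `6` hold the numbers of chores of price `1` and `2` in the bundles. -/
def Counted (M : Market n m) (s : State) : Prop :=
  ∀ v < n, s.arr 5 v = M.num 1 v ∧ s.arr 6 v = M.num 2 v

theorem card_filter_range_succ (k : ℕ) (P : ℕ → Prop) [DecidablePred P] :
    #{e ∈ range (k + 1) | P e} = #{e ∈ range k | P e} + if P k then 1 else 0 := by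
  rw [range_add_one, filter_insert]
  split_ifs
  · rw [card_insert_of_notMem (by simp)]
  · rfl

theorem runs_countProg (hn : n ≤ L) (hm : m ≤ L) (h0 : s.reg 0 = n) (h1 : s.reg 1 = m)
    (hM : (marketOf n m s).Valid) : Runs L countProg s (Counted (marketOf n m s)) := by
  set M := marketOf n m s with hMdef
  refine Runs.seq ((Runs.forLt (fun k s' => ∀ v < k, s'.arr 5 v = 0 ∧ s'.arr 6 v = 0) (by omega)
    (by simp [Program.KeepsReg]) (by simp [Program.KeepsReg]) (by omega) (fun _ _ _ h => h)
    (by simp) ?_).mono ?_)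
  · intro k _ s' _ hk hI
    refine Runs.seq (Runs.write (Runs.write fun v hv => ?_))
    by_cases hvk : v = k
    · subst hvk; simp [Expr.eval, hk]
    · simpa [Expr.eval, hk, hvk] using hI v (by omega)
  intro s₁ hA₁ hz
  have e1 : s₁.reg 1 = m := by rw [hA₁.reg 1 (by simp [Program.KeepsReg]), h1]
  have a1 : s₁.arr 1 = M.owner := hA₁.arr 1 (by simp [Program.KeepsArr])
  have a4 : s₁.arr 4 = M.price := hA₁.arr 4 (by simp [Program.KeepsArr])
  refine (Runs.forLt (fun k s' => ∀ v < n,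
    s'.arr 5 v = #{e ∈ range k | M.price e = 1 ∧ M.owner e = v} ∧
    s'.arr 6 v = #{e ∈ range k | M.price e = 2 ∧ M.owner e = v}) (by omega)
    (by simp [Program.KeepsReg]) (by simp [Program.KeepsReg]) (by omega) (fun _ _ _ h => h)
    (fun v hv => by simpa using hz v (h0 ▸ hv)) ?_).mono ?_
  · intro k hk s' hA' hrk hI
    rw [e1] at hk
    have b1 : s'.arr 1 = M.owner := by rw [hA'.arr 1 (by simp [Program.KeepsArr]), a1]
    have b4 : s'.arr 4 = M.price := by rw [hA'.arr 4 (by simp [Program.KeepsArr]), a4]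
    refine Runs.branch (fun hg => Runs.write fun v hv => ?_)
      (fun hg => Runs.write fun v hv => ?_)
    all_goals
      simp only [Expr.holds_eq, Expr.eval, b4, hrk] at hg
      obtain ⟨i1, i2⟩ := hI v hv
      rw [card_filter_range_succ, card_filter_range_succ, ← i1, ← i2]
      simp only [Expr.eval, State.setArr_arr, b1, hrk, if_true, Nat.reduceEqDiff, if_false]
    · by_cases hvo : M.owner k = v
      · subst hvo; simp [hg]
      · simp [hg, hvo, Ne.symm hvo]
    · have hg2 : M.price k = 2 := (hM.price_eq k hk).resolve_left hg
      by_cases hvo : M.owner k = v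
      · subst hvo; simp [hg2]
      · simp [hg2, hvo, Ne.symm hvo]
  · intro s' _ hI
    rw [e1] at hI
    exact hI

/-- The total price of the bundle of the agent in register `x`. -/
def earnExpr (x : ℕ) : Expr :=
  .add (.read 5 (.reg x)) (.add (.read 6 (.reg x)) (.read 6 (.reg x)))

theorem eval_earnExpr {M : Market n m} (hc : Counted M s) {x : ℕ} (hx : s.reg x < n) :
    (earnExpr x).eval s = M.earn (s.reg x) := by
  obtain ⟨h1, h2⟩ := hc _ hx
  simp only [earnExpr, Expr.eval, h1, h2, Market.earn]
  omega

/-- The triple in the registers `20`, `21`, `22` is improving. -/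
def improvesExpr : Expr :=
  .disj (.conj (.eq (.reg 21) (.reg 22)) (.lt (.add (earnExpr 21) (.const 1)) (earnExpr 20)))
  (.disj (.conj (.eq (.reg 20) (.reg 21))
    (.disj (.lt (.add (earnExpr 22) (.const 2)) (earnExpr 20))
      (.conj (.lt (.add (earnExpr 22) (.const 1)) (earnExpr 20))
        (.conj (.read 5 (.reg 20)) (.neg (.read 5 (.reg 22)))))))
  (.disj (.conj (.eq (.reg 20) (.reg 22)) (.lt (.add (earnExpr 22) (.const 1)) (earnExpr 21)))
  (.conj (.ne (.reg 20) (.reg 21)) (.conj (.neg (.read 6 (.reg 20)))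
    (.conj (.neg (.lt (.add (earnExpr 21) (.const 1)) (earnExpr 20)))
      (.lt (.add (earnExpr 22) (.const 1)) (earnExpr 20)))))))

theorem holds_improvesExpr {M : Market n m} (hc : Counted M s) (h20 : s.reg 20 < n)
    (h21 : s.reg 21 < n) (h22 : s.reg 22 < n) :
    improvesExpr.Holds s ↔ M.Improves (s.reg 20) (s.reg 21) (s.reg 22) := by
  simp only [improvesExpr, Expr.holds_disj, Expr.holds_conj, Expr.holds_eq, Expr.holds_lt,
    Expr.holds_neg, Expr.holds_ne, Expr.holds_read, Expr.eval, eval_earnExpr hc h20,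
    eval_earnExpr hc h21, eval_earnExpr hc h22, (hc _ h20).1, (hc _ h20).2, (hc _ h22).1,
    Market.Improves]
  omega

/-- Record the triple in the registers `20`, `21`, `22` if it is improving. -/
def recordProg : Program :=
  .branch (.conj (.read 9 (.reg 22)) improvesExpr)
    (.seq (.assign 23 (.const 1)) (.seq (.assign 24 (.reg 20))
      (.seq (.assign 25 (.reg 21)) (.assign 26 (.reg 22))))) .skip

/-- Search for improving triples. -/
def findProg : Program :=
  .seq (.assign 23 (.const 0))
    (.forLt 20 0 (.seq (searchProg 1 20 7 8)
      (.forLt 21 0 (.branch (.read 7 (.reg 21))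
        (.seq (searchProg 2 21 9 10) (.forLt 22 0 recordProg)) .skip))))

theorem keepsReg_recordProg {z : ℕ} (h : z < 23 ∨ 26 < z) : recordProg.KeepsReg z := by
  simp [recordProg, Program.KeepsReg]
  omega

theorem keepsArr_recordProg (a : ℕ) : recordProg.KeepsArr a := by
  simp [recordProg, Program.KeepsArr]

theorem keepsReg_findProg {z : ℕ} (h : z < 10 ∨ 26 < z) : findProg.KeepsReg z := by
  have h1 := keepsReg_recordProg (z := z) (by omega)
  have h2 : ∀ q x vis via, (searchProg q x vis via).KeepsReg z := fun q x vis via =>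
    keepsReg_searchProg (by omega) (by omega) (by omega) (by omega)
  simp [findProg, Program.KeepsReg, h1, h2]
  omega

theorem keepsArr_findProg {a : ℕ} (h : a < 7) : findProg.KeepsArr a := by
  have h1 : (searchProg 1 20 7 8).KeepsArr a := keepsArr_searchProg (by omega) (by omega)
  have h2 : (searchProg 2 21 9 10).KeepsArr a := keepsArr_searchProg (by omega) (by omega)
  simp [findProg, Program.KeepsArr, h1, h2, keepsArr_recordProg]

/-- The triple in the registers `24`, `25`, `26` is valid if one is recorded; otherwise no triple
below `(a, b, d)` is improving. -/
def FindInv (M : Market n m) (a b d : ℕ) (s : State) : Prop :=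
  (s.reg 23 ≠ 0 → s.reg 24 < n ∧ s.reg 25 < n ∧ s.reg 26 < n ∧ M.Reach 1 (s.reg 24) (s.reg 25) ∧
    M.Reach 2 (s.reg 25) (s.reg 26) ∧ M.Improves (s.reg 24) (s.reg 25) (s.reg 26)) ∧
  (s.reg 23 = 0 → ∀ i < n, ∀ k < n, ∀ j < n,
    (i < a ∨ (i = a ∧ (k < b ∨ (k = b ∧ j < d)))) → M.Reach 1 i k → M.Reach 2 k j →
      ¬ M.Improves i k j)

theorem FindInv.congr {M : Market n m} {a b d : ℕ} {s s' : State} (h : FindInv M a b d s)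
    (h23 : s'.reg 23 = s.reg 23) (h24 : s'.reg 24 = s.reg 24) (h25 : s'.reg 25 = s.reg 25)
    (h26 : s'.reg 26 = s.reg 26) : FindInv M a b d s' := by
  unfold FindInv
  rw [h23, h24, h25, h26]
  exact h

theorem FindInv.setReg {M : Market n m} {a b d x v : ℕ} {s : State} (h : FindInv M a b d s)
    (hx : x < 23) : FindInv M a b d (s.setReg x v) :=
  h.congr (by simp; omega) (by simp; omega) (by simp; omega) (by simp; omega)

theorem FindInv.mono {M : Market n m} {a b d a' b' d' : ℕ} {s : State} (h : FindInv M a b d s)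
    (hlt : ∀ i < n, ∀ k < n, ∀ j < n, M.Reach 1 i k → M.Reach 2 k j →
      (i < a' ∨ (i = a' ∧ (k < b' ∨ (k = b' ∧ j < d')))) →
      (i < a ∨ (i = a ∧ (k < b ∨ (k = b ∧ j < d))))) : FindInv M a' b' d' s :=
  ⟨h.1, fun h0 i hi k hk j hj hl h1 h2 => h.2 h0 i hi k hk j hj (hlt i hi k hk j hj h1 h2 hl) h1 h2⟩

theorem runs_recordProg {M : Market n m} {i k j : ℕ} (hc : Counted M s) (h20 : s.reg 20 = i)
    (h21 : s.reg 21 = k) (h22 : s.reg 22 = j) (hi : i < n) (hk : k < n) (hj : j < n)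
    (hik : M.Reach 1 i k) (hkj : s.arr 9 j ≠ 0 ↔ M.Reach 2 k j) (h : FindInv M i k j s) :
    Runs L recordProg s (FindInv M i k (j + 1)) := by
  have himp := holds_improvesExpr hc (h20 ▸ hi) (h21 ▸ hk) (h22 ▸ hj)
  rw [h20, h21, h22] at himp
  refine Runs.branch (fun hg => ?_) (fun hg => Runs.skip ?_)
  · refine Runs.seq (Runs.assign (Runs.seq (Runs.assign (Runs.seq (Runs.assign
      (Runs.assign ?_))))))
    simp only [Expr.holds_conj, Expr.holds_read, Expr.eval, h22, hkj, himp] at hg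
    simp [FindInv, Expr.eval, h20, h21, h22, hi, hk, hj, hik, hg]
  · simp only [Expr.holds_conj, Expr.holds_read, Expr.eval, h22, hkj, himp] at hg
    refine ⟨h.1, fun h0 i' hi' k' hk' j' hj' hl h1 h2 h3 => ?_⟩
    by_cases he : i' = i ∧ k' = k ∧ j' = j
    · obtain ⟨rfl, rfl, rfl⟩ := he
      exact hg ⟨h2, h3⟩
    · exact h.2 h0 i' hi' k' hk' j' hj' (by omega) h1 h2 h3

theorem runs_findProg (hn : n < L) (hm : m ≤ L) (h0 : s.reg 0 = n) (h1 : s.reg 1 = m)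
    (hM : (marketOf n m s).Valid) (hc : Counted (marketOf n m s) s) :
    Runs L findProg s (FindInv (marketOf n m s) n 0 0) := by
  set M := marketOf n m s with hMdef
  have hs1r : ∀ z, z < 10 ∨ 13 < z → (searchProg 1 20 7 8).KeepsReg z := fun z hz =>
    keepsReg_searchProg (by omega) (by omega) (by omega) (by omega)
  have hs2r : ∀ z, z < 10 ∨ 13 < z → (searchProg 2 21 9 10).KeepsReg z := fun z hz =>
    keepsReg_searchProg (by omega) (by omega) (by omega) (by omega)
  have hs1a : ∀ a, a ≠ 7 → a ≠ 8 → (searchProg 1 20 7 8).KeepsArr a := fun a h h' =>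
    keepsArr_searchProg h h'
  have hs2a : ∀ a, a ≠ 9 → a ≠ 10 → (searchProg 2 21 9 10).KeepsArr a := fun a h h' =>
    keepsArr_searchProg h h'
  refine Runs.seq (Runs.assign ?_)
  set s₁ := s.setReg 23 (Expr.eval s (.const 0)) with hs₁
  have ctx : ∀ {p : Program} {t t' : State}, Agree p t t' → p.KeepsReg 0 → p.KeepsReg 1 →
      (∀ a < 7, p.KeepsArr a) → (t.reg 0 = n ∧ t.reg 1 = m ∧ marketOf n m t = M ∧ Counted M t) →
      (t'.reg 0 = n ∧ t'.reg 1 = m ∧ marketOf n m t' = M ∧ Counted M t') := by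
    rintro p t t' hA k0 k1 ka ⟨g0, g1, gM, gc⟩
    refine ⟨(hA.reg 0 k0).trans g0, (hA.reg 1 k1).trans g1,
      (marketOf_congr fun a ha => hA.arr a (ka a (by omega))).trans gM, fun v hv => ?_⟩
    rw [hA.arr 5 (ka 5 (by omega)), hA.arr 6 (ka 6 (by omega))]
    exact gc v hv
  have c₁ : s₁.reg 0 = n ∧ s₁.reg 1 = m ∧ marketOf n m s₁ = M ∧ Counted M s₁ :=
    ⟨by simp [hs₁, h0], by simp [hs₁, h1], rfl, hc⟩
  have hrec : ∀ z, z < 23 → recordProg.KeepsReg z := fun z hz => keepsReg_recordProg (.inl hz)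
  refine (Runs.forLt (fun k s' => FindInv M k 0 0 s') (by omega) ?_ ?_ (by omega)
    (fun k s' v h => h.setReg (by omega)) ?_ ?_).mono ?_
  · simp [Program.KeepsReg, hs1r, hs2r, hrec]
  · simp [Program.KeepsReg, hs1r, hs2r, hrec]
  · exact ⟨fun h => by simp [hs₁, Expr.eval] at h, fun _ i _ k _ j _ hl => by omega⟩
  · intro i hi s₂ hA₂ hr₂ hI₂
    rw [c₁.1] at hi
    have c₂ := ctx hA₂ (by simp [Program.KeepsReg, hs1r, hs2r, hrec])
      (by simp [Program.KeepsReg, hs1r, hs2r, hrec]) (fun a ha => by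
        simp [Program.KeepsArr, hs1a a (by omega) (by omega), hs2a a (by omega) (by omega),
          keepsArr_recordProg]) c₁
    refine Runs.seq ((runs_searchProg hn hm c₂.1 c₂.2.1 (by rw [c₂.2.2.1]; exact hM)
      (hr₂ ▸ hi) (by omega) (by omega) (by omega) (by omega)).mono ?_)
    rintro s₃ hA₃ ⟨ht₃, -, hcl₃⟩
    rw [c₂.2.2.1, hr₂] at ht₃
    rw [c₂.2.2.1] at hcl₃
    have c₃ := ctx hA₃ (hs1r _ (by omega)) (hs1r _ (by omega))
      (fun a ha => hs1a a (by omega) (by omega)) c₂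
    have hr₃ : s₃.reg 20 = i := by rw [hA₃.reg 20 (hs1r _ (by omega)), hr₂]
    have hI₃ : FindInv M i 0 0 s₃ := hI₂.congr (hA₃.reg _ (hs1r _ (by omega)))
      (hA₃.reg _ (hs1r _ (by omega))) (hA₃.reg _ (hs1r _ (by omega)))
      (hA₃.reg _ (hs1r _ (by omega)))
    refine (Runs.forLt (fun k s' => FindInv M i k 0 s') (by omega) ?_ ?_ (by omega)
      (fun k s' v h => h.setReg (by omega)) hI₃ ?_).mono ?_
    · simp [Program.KeepsReg, hs2r, hrec]
    · simp [Program.KeepsReg, hs2r, hrec]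
    · intro k hk s₄ hA₄ hr₄ hI₄
      rw [c₃.1] at hk
      have c₄ := ctx hA₄ (by simp [Program.KeepsReg, hs2r, hrec])
        (by simp [Program.KeepsReg, hs2r, hrec]) (fun a ha => by
          simp [Program.KeepsArr, hs2a a (by omega) (by omega), keepsArr_recordProg]) c₃
      have hr20 : s₄.reg 20 = i := by
        rw [hA₄.reg 20 (by simp [Program.KeepsReg, hs2r, hrec]), hr₃]
      have hv : s₄.arr 7 = s₃.arr 7 :=
        hA₄.arr 7 (by simp [Program.KeepsArr, hs2a, keepsArr_recordProg])
      have hreach := ht₃.reach_iff hM hcl₃ hk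
      refine Runs.branch (fun hg => ?_) (fun hg => Runs.skip ?_)
      · simp only [Expr.holds_read, Expr.eval, hr₄, hv, hreach] at hg
        refine Runs.seq ((runs_searchProg hn hm c₄.1 c₄.2.1 (by rw [c₄.2.2.1]; exact hM)
          (hr₄ ▸ hk) (by omega) (by omega) (by omega) (by omega)).mono ?_)
        rintro s₅ hA₅ ⟨ht₅, -, hcl₅⟩
        rw [c₄.2.2.1, hr₄] at ht₅
        rw [c₄.2.2.1] at hcl₅
        have c₅ := ctx hA₅ (hs2r _ (by omega)) (hs2r _ (by omega))
          (fun a ha => hs2a a (by omega) (by omega)) c₄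
        have hI₅ : FindInv M i k 0 s₅ := hI₄.congr (hA₅.reg _ (hs2r _ (by omega)))
          (hA₅.reg _ (hs2r _ (by omega))) (hA₅.reg _ (hs2r _ (by omega)))
          (hA₅.reg _ (hs2r _ (by omega)))
        refine (Runs.forLt (fun j s' => FindInv M i k j s') (by omega) (hrec _ (by omega))
          (hrec _ (by omega)) (by omega) (fun k s' v h => h.setReg (by omega)) hI₅ ?_).mono ?_
        · intro j hj s₆ hA₆ hr₆ hI₆
          rw [c₅.1] at hj
          have c₆ := ctx hA₆ (by simp [hrec]) (by simp [hrec])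
            (fun a ha => by simp [keepsArr_recordProg]) c₅
          refine runs_recordProg c₆.2.2.2 ?_ ?_ hr₆ hi hk hj hg ?_ hI₆
          · rw [hA₆.reg 20 (by simp [hrec]), hA₅.reg 20 (hs2r _ (by omega)), hr20]
          · rw [hA₆.reg 21 (by simp [hrec]), hA₅.reg 21 (hs2r _ (by omega)), hr₄]
          · rw [hA₆.arr 9 (by simp [keepsArr_recordProg])]
            exact ht₅.reach_iff hM hcl₅ hj
        · intro s₆ _ hI₆
          rw [c₅.1] at hI₆
          exact hI₆.mono fun _ _ _ _ _ _ _ _ _ => by omega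
      · simp only [Expr.holds_read, Expr.eval, hr₄, hv, hreach] at hg
        -- An unmarked `k` is not reachable from `i` at price 1, so all triples through this pair
        -- can be skipped.
        refine hI₄.mono fun i' _ k' _ j' _ h1 _ hl => ?_
        by_cases he : i' = i ∧ k' = k
        · obtain ⟨rfl, rfl⟩ := he
          exact absurd h1 hg
        · omega
    · intro s₄ _ hI₄
      rw [c₃.1] at hI₄
      exact hI₄.mono fun _ _ _ _ _ _ _ _ _ => by omega
  · intro s₂ _ hI₂
    rw [c₁.1] at hI₂
    exact hI₂

end Chores

/-! ### One round of the algorithm and the initial equilibrium. -/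

namespace Chores

open Finset Relation RAM

variable {n m L : ℕ} {s : State}

/-- Edges at one price depend only on chores of that price, so the price-2 half of a move survives
its price-1 half. -/
theorem Market.Shifted.reach_iff {M M' : Market n m} {q q' x y v w : ℕ}
    (h : Market.Shifted q M M' x y) (hq : q' ≠ q) : M'.Reach q' v w ↔ M.Reach q' v w := by
  have : M'.Edge q' = M.Edge q' := by
    ext v w
    simp only [Market.Edge, h.cost, h.raised, h.price]
    refine and_congr_right fun _ => exists_congr fun e => and_congr_right fun _ =>
      and_congr_right fun hp => ?_
    rw [h.owner e (hp ▸ hq)]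
  rw [Market.Reach, Market.Reach, this]

/-- Carry out the recorded move. -/
def improveProg : Program :=
  .seq (searchProg 1 24 7 8) (.seq (walkProg 24 25 8)
    (.seq (searchProg 2 25 9 10) (walkProg 25 26 10)))

theorem keepsReg_improveProg {z : ℕ} (h : z < 10 ∨ 16 < z) : improveProg.KeepsReg z :=
  ⟨keepsReg_searchProg (by omega) (by omega) (by omega) (by omega),
    keepsReg_walkProg (by omega) (by omega) (by omega),
    keepsReg_searchProg (by omega) (by omega) (by omega) (by omega),
    keepsReg_walkProg (by omega) (by omega) (by omega)⟩

theorem runs_improveProg (hn : n < L) (hm : m ≤ L) (h0 : s.reg 0 = n) (h1 : s.reg 1 = m)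
    (hM : (marketOf n m s).Valid) (hi : s.reg 24 < n) (hk : s.reg 25 < n) (hj : s.reg 26 < n)
    (hik : (marketOf n m s).Reach 1 (s.reg 24) (s.reg 25))
    (hkj : (marketOf n m s).Reach 2 (s.reg 25) (s.reg 26)) :
    Runs L improveProg s fun s' => ∃ M₁ : Market n m,
      Market.Shifted 1 (marketOf n m s) M₁ (s.reg 24) (s.reg 25) ∧
      Market.Shifted 2 M₁ (marketOf n m s') (s.reg 25) (s.reg 26) := by
  set M := marketOf n m s with hMdef
  refine Runs.seq ((runs_searchProg hn hm h0 h1 hM hi (by omega) (by omega) (by omega)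
    (by omega)).mono ?_)
  rintro s₁ hA₁ ⟨ht₁, hle₁, hcl₁⟩
  have k₁ : ∀ z, z < 10 ∨ 13 < z → s₁.reg z = s.reg z := fun z hz =>
    hA₁.reg z (keepsReg_searchProg (by omega) (by omega) (by omega) (by omega))
  have M₁ : marketOf n m s₁ = M := marketOf_congr fun a ha =>
    hA₁.arr a (keepsArr_searchProg (by omega) (by omega))
  refine Runs.seq ((runs_walkProg (n := n) (m := m) (q := 1) (vis := s₁.arr 7) (M₁ ▸ hM)
    (by rw [M₁, k₁ 24 (by omega)]; exact ht₁) (fun v hv => (hle₁ v hv).trans hn.le)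
    (by rw [k₁ 25 (by omega)]; exact hk)
    (by rw [k₁ 25 (by omega)]; exact (ht₁.reach_iff hM hcl₁ hk).2 hik) (by omega)
    (by omega)).mono ?_)
  intro s₂ hA₂ hsh₂
  have k₂ : ∀ z, z < 10 ∨ 16 < z → s₂.reg z = s.reg z := fun z hz =>
    (hA₂.reg z (keepsReg_walkProg (by omega) (by omega) (by omega))).trans (k₁ z (by omega))
  rw [M₁, k₁ 24 (by omega), k₁ 25 (by omega)] at hsh₂
  have hM₂ := hsh₂.valid
  refine Runs.seq ((runs_searchProg (q := 2) (x := 25) (vis := 9) (via := 10) hn hm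
    ((k₂ 0 (by omega)).trans h0) ((k₂ 1 (by omega)).trans h1) hM₂
    (by rw [k₂ 25 (by omega)]; exact hk) (by omega) (by omega) (by omega) (by omega)).mono ?_)
  rintro s₃ hA₃ ⟨ht₃, hle₃, hcl₃⟩
  have k₃ : ∀ z, z < 10 ∨ 16 < z → s₃.reg z = s.reg z := fun z hz =>
    (hA₃.reg z (keepsReg_searchProg (by omega) (by omega) (by omega) (by omega))).trans
      (k₂ z (by omega))
  have M₃ : marketOf n m s₃ = marketOf n m s₂ := marketOf_congr fun a ha =>
    hA₃.arr a (keepsArr_searchProg (by omega) (by omega))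
  rw [k₂ 25 (by omega)] at ht₃
  refine (runs_walkProg (n := n) (m := m) (q := 2) (vis := s₃.arr 9) (M₃ ▸ hM₂)
    (by rw [M₃, k₃ 25 (by omega)]; exact ht₃) (fun v hv => (hle₃ v hv).trans hn.le)
    (by rw [k₃ 26 (by omega)]; exact hj)
    (by rw [k₃ 26 (by omega)]
        exact (ht₃.reach_iff hM₂ hcl₃ hj).2 ((hsh₂.reach_iff (by omega)).2 hkj)) (by omega)
    (by omega)).mono ?_
  intro s₄ hA₄ hsh₄
  rw [M₃, k₃ 25 (by omega), k₃ 26 (by omega)] at hsh₄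
  exact ⟨_, hsh₂, hsh₄⟩

/-- Find the agent of maximal load among those without chores of price `2`. -/
def pickProg : Program :=
  .seq (.assign 27 (.const 0)) (.seq (.assign 28 (.const 0)) (.seq
    (.forLt 29 0 (.branch (.conj (.neg (.read 6 (.reg 29))) (.lt (.reg 27) (.read 5 (.reg 29))))
      (.seq (.assign 27 (.read 5 (.reg 29))) (.assign 28 (.reg 29))) .skip))
    (.seq (.assign 30 (.const 0))
      (.forLt 29 0 (.branch (.lt (.add (earnExpr 29) (.const 1)) (.reg 27))
        (.assign 30 (.const 1)) .skip)))))

theorem keepsReg_pickProg {z : ℕ} (h : z < 27 ∨ 30 < z) : pickProg.KeepsReg z := by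
  simp [pickProg, Program.KeepsReg]
  omega

theorem keepsArr_pickProg (a : ℕ) : pickProg.KeepsArr a := by
  simp [pickProg, Program.KeepsArr]

theorem runs_pickProg {M : Market n m} (hn : n ≤ L) (h0 : s.reg 0 = n) (hc : Counted M s) :
    Runs L pickProg s fun s' =>
      (s'.reg 30 ≠ 0 → s'.reg 28 < n ∧ M.num 2 (s'.reg 28) = 0 ∧
        (∀ v < n, M.num 2 v = 0 → M.num 1 v ≤ M.num 1 (s'.reg 28)) ∧
        ∃ j < n, M.earn j + 2 ≤ M.earn (s'.reg 28)) ∧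
      (s'.reg 30 = 0 → M.Settled) := by
  refine Runs.seq (Runs.assign (Runs.seq (Runs.assign (Runs.seq ?_))))
  set s₁ := (s.setReg 27 (Expr.eval s (.const 0))).setReg 28
    (Expr.eval (s.setReg 27 (Expr.eval s (.const 0))) (.const 0)) with hs₁
  have e0 : s₁.reg 0 = n := by simp [hs₁, h0]
  have c₁ : Counted M s₁ := hc
  refine (Runs.forLt (fun k s' => (∀ v < k, M.num 2 v = 0 → M.num 1 v ≤ s'.reg 27) ∧
    (s'.reg 27 = 0 ∨ (s'.reg 28 < n ∧ M.num 2 (s'.reg 28) = 0 ∧ M.num 1 (s'.reg 28) = s'.reg 27)))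
    (by omega) (by simp [Program.KeepsReg]) (by simp [Program.KeepsReg]) (by omega)
    (fun k s' v h => by simpa using h) (by simp [hs₁, Expr.eval]) ?_).mono ?_
  · rintro k hk s' hA hr ⟨hI1, hI2⟩
    rw [e0] at hk
    have c5 : s'.arr 5 k = M.num 1 k := by
      rw [hA.arr 5 (by simp [Program.KeepsArr])]; exact (c₁ k hk).1
    have c6 : s'.arr 6 k = M.num 2 k := by
      rw [hA.arr 6 (by simp [Program.KeepsArr])]; exact (c₁ k hk).2
    refine Runs.branch (fun hg => ?_) (fun hg => Runs.skip ?_)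
    all_goals simp only [Expr.holds_conj, Expr.holds_neg, Expr.holds_read, Expr.holds_lt,
      Expr.eval, hr, c5, c6, not_not] at hg
    · refine Runs.seq (Runs.assign (Runs.assign ?_))
      simp only [Expr.eval, State.setReg_reg, if_true, hr, c5, Nat.reduceEqDiff, if_false]
      refine ⟨fun v hv hv2 => ?_, .inr ⟨hk, hg.1, trivial⟩⟩
      rcases Nat.lt_succ_iff_lt_or_eq.1 hv with hv | rfl
      · exact (hI1 v hv hv2).trans hg.2.le
      · exact le_rfl
    · refine ⟨fun v hv hv2 => ?_, hI2⟩
      rcases Nat.lt_succ_iff_lt_or_eq.1 hv with hv | rfl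
      · exact hI1 v hv hv2
      · by_contra hlt
        exact hg ⟨hv2, not_le.1 hlt⟩
  rintro s₂ hA₂ ⟨hI1, hI2⟩
  rw [e0] at hI1
  have e2 : s₂.reg 0 = n := by rw [hA₂.reg 0 (by simp [Program.KeepsReg]), e0]
  have c₂ : Counted M s₂ := fun v hv => by
    rw [hA₂.arr 5 (by simp [Program.KeepsArr]), hA₂.arr 6 (by simp [Program.KeepsArr])]
    exact c₁ v hv
  refine Runs.seq (Runs.assign ?_)
  refine (Runs.forLt (fun k s' => (s'.reg 30 ≠ 0 → ∃ j < n, M.earn j + 1 < s₂.reg 27) ∧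
    (s'.reg 30 = 0 → ∀ j < k, s₂.reg 27 ≤ M.earn j + 1))
    (by omega) (by simp [Program.KeepsReg]) (by simp [Program.KeepsReg]) (by simp; omega)
    (fun k s' v h => by simpa using h) (by simp [Expr.eval]) ?_).mono ?_
  · rintro k hk s' hA hr ⟨hJ1, hJ2⟩
    have hk : k < n := by simpa [e2] using hk
    have c' : Counted M s' := fun v hv => by
      rw [hA.arr 5 (by simp [Program.KeepsArr]), hA.arr 6 (by simp [Program.KeepsArr])]
      exact c₂ v hv
    have r27 : s'.reg 27 = s₂.reg 27 := by
      rw [hA.reg 27 (by simp [Program.KeepsReg])]; simp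
    have hearn := eval_earnExpr c' (x := 29) (hr ▸ hk)
    refine Runs.branch (fun hg => Runs.assign ?_) (fun hg => Runs.skip ?_)
    all_goals simp only [Expr.holds_lt, Expr.eval, hearn, hr, r27] at hg
    · exact ⟨fun _ => ⟨k, hk, hg⟩, fun h => by simp [Expr.eval] at h⟩
    · refine ⟨hJ1, fun h j hj => ?_⟩
      rcases Nat.lt_succ_iff_lt_or_eq.1 hj with hj | rfl
      · exact hJ2 h j hj
      · omega
  · rintro s₃ hA₃ ⟨hJ1, hJ2⟩
    have r27 : s₃.reg 28 = s₂.reg 28 := by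
      rw [hA₃.reg 28 (by simp [Program.KeepsReg])]; simp
    rw [r27]
    refine ⟨fun h => ?_, fun h i hi hi2 j hj => ?_⟩
    · obtain ⟨j, hj, hlt⟩ := hJ1 h
      -- A maximum of 0 never sets the flag, so the default agent in register 28 is not used in that
      -- case.
      obtain ⟨g1, g2, g3⟩ := hI2.resolve_left (by omega)
      refine ⟨g1, g2, fun v hv hv2 => g3 ▸ hI1 v hv hv2, j, hj, ?_⟩
      have : M.earn (s₂.reg 28) = M.num 1 (s₂.reg 28) + 2 * M.num 2 (s₂.reg 28) := rfl
      omega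
    · have h1 := hJ2 h j (by simpa [e2] using hj)
      have h2 := hI1 i hi hi2
      have : M.earn i = M.num 1 i + 2 * M.num 2 i := rfl
      omega

/-- Raise the agents reachable from the one in register `28`. -/
def raiseProg : Program :=
  .seq (searchProg 1 28 7 8) (.seq
    (.forLt 29 0 (.branch (.read 7 (.reg 29)) (.write 3 (.reg 29) (.const 1)) .skip))
    (.forLt 31 1 (.branch (.read 7 (.read 1 (.reg 31))) (.write 4 (.reg 31) (.const 2)) .skip)))

theorem keepsReg_raiseProg {z : ℕ} (h : z < 10 ∨ 31 < z) : raiseProg.KeepsReg z := by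
  have h1 : (searchProg 1 28 7 8).KeepsReg z :=
    keepsReg_searchProg (by omega) (by omega) (by omega) (by omega)
  simp [raiseProg, Program.KeepsReg, h1]
  omega

theorem runs_raiseProg (hn : n < L) (hm : m ≤ L) (h0 : s.reg 0 = n) (h1 : s.reg 1 = m)
    (hM : (marketOf n m s).Valid) (hi : s.reg 28 < n) :
    Runs L raiseProg s fun s' => Market.IsRaise (marketOf n m s) (marketOf n m s')
      ((marketOf n m s).Reach 1 (s.reg 28)) := by
  set M := marketOf n m s with hMdef
  refine Runs.seq ((runs_searchProg hn hm h0 h1 hM hi (by omega) (by omega) (by omega)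
    (by omega)).mono ?_)
  rintro s₁ hA₁ ⟨ht₁, -, hcl₁⟩
  have k₁ : ∀ z, z < 10 → s₁.reg z = s.reg z := fun z hz =>
    hA₁.reg z (keepsReg_searchProg (by omega) (by omega) (by omega) (by omega))
  have a₁ : ∀ a, a < 5 → s₁.arr a = s.arr a := fun a ha =>
    hA₁.arr a (keepsArr_searchProg (by omega) (by omega))
  have hreach : ∀ v < n, s₁.arr 7 v ≠ 0 ↔ M.Reach 1 (s.reg 28) v := fun v hv =>
    ht₁.reach_iff hM hcl₁ hv
  refine Runs.seq ((Runs.forLt (fun k s' => ∀ v < n, s'.arr 3 v =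
    if v < k ∧ s₁.arr 7 v ≠ 0 then 1 else s.arr 3 v) (by omega) (by simp [Program.KeepsReg])
    (by simp [Program.KeepsReg]) (by rw [k₁ 0 (by omega)]; omega) (fun _ _ _ h => h)
    (by simp [a₁]) ?_).mono ?_)
  · intro k hk s' hA hr hI
    have b7 : s'.arr 7 = s₁.arr 7 := hA.arr 7 (by simp [Program.KeepsArr])
    refine Runs.branch (fun hg => Runs.write fun v hv => ?_) (fun hg => Runs.skip fun v hv => ?_)
    all_goals
      simp only [Expr.holds_read, Expr.eval, hr, b7] at hg
      have hIv := hI v hv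
      rcases lt_trichotomy v k with hvk | rfl | hvk
    · simpa [Expr.eval, hr, hvk.ne, hvk, hvk.trans (Nat.lt_succ_self k)] using hIv
    · simp [Expr.eval, hr, hg]
    · simpa [Expr.eval, hr, hvk.ne', hvk.not_gt, Nat.not_lt.2 (Nat.succ_le_of_lt hvk)] using hIv
    · simpa [hvk, hvk.trans (Nat.lt_succ_self k)] using hIv
    · simpa [hg] using hIv
    · simpa [hvk.not_gt, Nat.not_lt.2 (Nat.succ_le_of_lt hvk)] using hIv
  intro s₂ hA₂ hI₂
  have e1 : s₂.reg 1 = m := by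
    rw [hA₂.reg 1 (by simp [Program.KeepsReg]), k₁ 1 (by omega), h1]
  have a₂ : ∀ a, a < 5 → a ≠ 3 → s₂.arr a = s.arr a := fun a ha ha3 =>
    (hA₂.arr a (by simp [Program.KeepsArr, ha3])).trans (a₁ a ha)
  have b₂ : s₂.arr 7 = s₁.arr 7 := hA₂.arr 7 (by simp [Program.KeepsArr])
  refine (Runs.forLt (fun k s' => ∀ e < m, s'.arr 4 e =
    if e < k ∧ s₁.arr 7 (s.arr 1 e) ≠ 0 then 2 else s.arr 4 e) (by omega)
    (by simp [Program.KeepsReg]) (by simp [Program.KeepsReg]) (by omega) (fun _ _ _ h => h)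
    (by simp [a₂]) ?_).mono ?_
  · intro k hk s' hA hr hI
    have b7 : s'.arr 7 = s₁.arr 7 := (hA.arr 7 (by simp [Program.KeepsArr])).trans b₂
    have b1 : s'.arr 1 = s.arr 1 :=
      (hA.arr 1 (by simp [Program.KeepsArr])).trans (a₂ 1 (by omega) (by omega))
    refine Runs.branch (fun hg => Runs.write fun v hv => ?_) (fun hg => Runs.skip fun v hv => ?_)
    all_goals
      simp only [Expr.holds_read, Expr.eval, hr, b7, b1] at hg
      have hIv := hI v hv
      rcases lt_trichotomy v k with hvk | rfl | hvk
    · simpa [Expr.eval, hr, hvk.ne, hvk, hvk.trans (Nat.lt_succ_self k)] using hIv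
    · simp [Expr.eval, hr, hg]
    · simpa [Expr.eval, hr, hvk.ne', hvk.not_gt, Nat.not_lt.2 (Nat.succ_le_of_lt hvk)] using hIv
    · simpa [hvk, hvk.trans (Nat.lt_succ_self k)] using hIv
    · simpa [hg] using hIv
    · simpa [hvk.not_gt, Nat.not_lt.2 (Nat.succ_le_of_lt hvk)] using hIv
  · intro s₃ hA₃ hI₃
    rw [e1] at hI₃
    have a₃ : ∀ a, a < 5 → a ≠ 3 → a ≠ 4 → s₃.arr a = s.arr a := fun a ha ha3 ha4 =>
      (hA₃.arr a (by simp [Program.KeepsArr, ha4])).trans (a₂ a ha ha3)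
    have a3 : s₃.arr 3 = s₂.arr 3 := hA₃.arr 3 (by simp [Program.KeepsArr])
    have e0 : s₁.reg 0 = n := (k₁ 0 (by omega)).trans h0
    rw [e0] at hI₂
    refine ⟨?_, ?_, fun v hv hR => ?_, fun v hv hR => ?_, fun e he hR => ?_, fun e he hR => ?_⟩
    · simp [hMdef, marketOf, a₃]
    · simp [hMdef, marketOf, a₃]
    · have := hI₂ v hv
      rwa [if_pos ⟨hv, (hreach v hv).2 hR⟩, ← a3] at this
    · have := hI₂ v hv
      rwa [if_neg fun h => hR ((hreach v hv).1 h.2), ← a3] at this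
    · have := hI₃ e he
      rwa [if_pos ⟨he, (hreach _ (hM.owner_lt e he)).2 hR⟩] at this
    · have := hI₃ e he
      rwa [if_neg fun h => hR ((hreach _ (hM.owner_lt e he)).1 h.2)] at this

/-- One round of the algorithm; register `32` is cleared when nothing remains to be done. -/
def roundProg : Program :=
  .seq countProg (.seq findProg (.branch (.reg 23) improveProg
    (.seq pickProg (.branch (.reg 30) raiseProg (.assign 32 (.const 0))))))

/-- The invariant of the main loop. -/
def MainInv (c : ℕ → ℕ → ℕ) (n m : ℕ) (s : State) : Prop :=
  s.reg 0 = n ∧ s.reg 1 = m ∧ (marketOf n m s).Valid ∧ (marketOf n m s).cost = c ∧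
    (∃ N, (marketOf n m s).Bounded N) ∧ s.reg 32 ≤ 1 ∧
    (s.reg 32 = 0 → (marketOf n m s).Stuck ∧ (marketOf n m s).Settled)

theorem runs_roundProg {c : ℕ → ℕ → ℕ} (hn : n < L) (hm : m ≤ L) (h : MainInv c n m s)
    (hgo : s.reg 32 = 1) :
    Runs L roundProg s fun s' => MainInv c n m s' ∧
      (marketOf n m s').rank + s'.reg 32 < (marketOf n m s).rank + s.reg 32 := by
  obtain ⟨h0, h1, hM, hcost, ⟨N, hb⟩, -, -⟩ := h
  set M := marketOf n m s with hMdef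
  refine Runs.seq ((runs_countProg hn.le hm h0 h1 hM).mono fun s₁ hA₁ hc₁ => ?_)
  have k₁ : ∀ z, z ≠ 17 → z ≠ 18 → s₁.reg z = s.reg z := fun z h17 h18 =>
    hA₁.reg z (keepsReg_countProg h17 h18)
  have M₁ : marketOf n m s₁ = M := marketOf_congr fun a ha =>
    hA₁.arr a (keepsArr_countProg (by omega) (by omega))
  refine Runs.seq ((runs_findProg hn hm ((k₁ 0 (by omega) (by omega)).trans h0)
    ((k₁ 1 (by omega) (by omega)).trans h1) (M₁ ▸ hM) (by rw [M₁]; exact hc₁)).mono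
    fun s₂ hA₂ hf => ?_)
  have k₂ : ∀ z, z < 10 ∨ 26 < z → s₂.reg z = s.reg z := fun z hz =>
    (hA₂.reg z (keepsReg_findProg hz)).trans (k₁ z (by omega) (by omega))
  have a₂ : ∀ a, a < 7 → s₂.arr a = s₁.arr a := fun a ha => hA₂.arr a (keepsArr_findProg ha)
  have M₂ : marketOf n m s₂ = M :=
    (marketOf_congr fun a ha => a₂ a (by omega)).trans M₁
  have c₂ : Counted M s₂ := fun v hv => by
    rw [a₂ 5 (by omega), a₂ 6 (by omega)]; exact hc₁ v hv
  rw [M₁] at hf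
  have r0 := (k₂ 0 (by omega)).trans h0
  have r1 := (k₂ 1 (by omega)).trans h1
  have r32 := (k₂ 32 (by omega)).trans hgo
  refine Runs.branch (fun hg => ?_) (fun hg => ?_)
  · obtain ⟨hi, hk, hj, hik, hkj, himp⟩ := hf.1 hg
    refine (runs_improveProg hn hm r0 r1 (by rw [M₂]; exact hM) hi hk hj (by rw [M₂]; exact hik)
      (by rw [M₂]; exact hkj)).mono ?_
    rintro s₃ hA₃ ⟨M', hs1, hs2⟩
    rw [M₂] at hs1
    obtain ⟨hb', hr'⟩ := hb.improve hs1 hs2 hi hk hj himp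
    have e32 : s₃.reg 32 = 1 := (hA₃.reg 32 (keepsReg_improveProg (by omega))).trans r32
    refine ⟨⟨?_, ?_, hs2.valid, ?_, ⟨N, hb'⟩, by omega, by omega⟩, by omega⟩
    · exact (hA₃.reg 0 (keepsReg_improveProg (by omega))).trans r0
    · exact (hA₃.reg 1 (keepsReg_improveProg (by omega))).trans r1
    · exact (hs2.cost.trans hs1.cost).trans hcost
  · have hstuck : M.Stuck := fun i hi k hk j hj =>
      hf.2 (not_not.1 hg) i hi k hk j hj (.inl hi)
    refine Runs.seq ((runs_pickProg hn.le r0 c₂).mono ?_)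
    rintro s₃ hA₃ ⟨hp1, hp2⟩
    have k₃ : ∀ z, z < 10 ∨ 30 < z → s₃.reg z = s.reg z := fun z hz =>
      (hA₃.reg z (keepsReg_pickProg (by omega))).trans (k₂ z (by omega))
    have M₃ : marketOf n m s₃ = M :=
      (marketOf_congr fun a _ => hA₃.arr a (keepsArr_pickProg a)).trans M₂
    have q0 := (k₃ 0 (by omega)).trans h0
    have q1 := (k₃ 1 (by omega)).trans h1
    have q32 := (k₃ 32 (by omega)).trans hgo
    refine Runs.branch (fun hg' => ?_) (fun hg' => Runs.assign ?_)
    · obtain ⟨hi, hi2, hmax, j, hj, hji⟩ := hp1 hg'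
      refine (runs_raiseProg hn hm q0 q1 (by rw [M₃]; exact hM) hi).mono ?_
      intro s₄ hA₄ hraise
      rw [M₃] at hraise
      obtain ⟨hv', hb', hr'⟩ := hM.raise hstuck hb hi hi2 hmax hj hji hraise
      have e32 : s₄.reg 32 = 1 := (hA₄.reg 32 (keepsReg_raiseProg (by omega))).trans q32
      refine ⟨⟨?_, ?_, hv', hraise.cost.trans hcost, hb', by omega, by omega⟩, by omega⟩
      · exact (hA₄.reg 0 (keepsReg_raiseProg (by omega))).trans q0
      · exact (hA₄.reg 1 (keepsReg_raiseProg (by omega))).trans q1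
    · have hset := hp2 (not_not.1 hg')
      -- Nothing but the flag changes in the final round, which is why register 32 is part of the
      -- measure.
      rw [MainInv, marketOf_setReg, M₃]
      refine ⟨⟨by simpa using q0, by simpa using q1, hM, hcost, ⟨N, hb⟩, by simp [Expr.eval],
        fun _ => ⟨hstuck, hset⟩⟩, ?_⟩
      simp [Expr.eval, hgo]

/-- Compute the row offsets and give every chore to an agent of minimal cost. -/
def initProg : Program :=
  .seq (.assign 33 (.const 0)) (.seq
    (.forLt 29 0 (.seq (.write 2 (.reg 29) (.reg 33)) (.assign 33 (.add (.reg 33) (.reg 1)))))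
    (.forLt 31 1 (.seq (.write 4 (.reg 31) (.const 2))
      (.forLt 29 0 (.branch (.eq (costExpr 29 31) (.const 1))
        (.seq (.write 1 (.reg 31) (.reg 29)) (.write 4 (.reg 31) (.const 1))) .skip)))))

/-- Chore `e` is held by an agent of minimal cost among the agents below `k`. -/
def InitInv (c : ℕ → ℕ → ℕ) (n k e : ℕ) (s : State) : Prop :=
  (s.arr 4 e = 2 ∧ s.arr 1 e = 0 ∧ ∀ v < k, c v e ≠ 1) ∨
    (s.arr 4 e = 1 ∧ s.arr 1 e < n ∧ c (s.arr 1 e) e = 1)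

theorem runs_initProg {c : ℕ → ℕ → ℕ} (hn : n ≤ L) (hm : m ≤ L) (hn0 : 0 < n) (h0 : s.reg 0 = n)
    (h1 : s.reg 1 = m) (hc : ∀ i < n, ∀ e < m, s.arr 0 (i * m + e) = c i e)
    (hc12 : ∀ i < n, ∀ e < m, c i e = 1 ∨ c i e = 2) (ha1 : ∀ e, s.arr 1 e = 0)
    (ha3 : ∀ e, s.arr 3 e = 0) :
    Runs L initProg s fun s' => (marketOf n m s').Valid ∧
      (∀ i < n, ∀ e < m, (marketOf n m s').cost i e = c i e) ∧
      (∀ i < n, (marketOf n m s').raised i = 0) ∧ s'.reg 0 = n ∧ s'.reg 1 = m := by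
  refine Runs.seq (Runs.assign (Runs.seq ((Runs.forLt (fun k s' => s'.reg 33 = k * m ∧
    ∀ v < k, s'.arr 2 v = v * m) (by omega) (by simp [Program.KeepsReg])
    (by simp [Program.KeepsReg]) (by simp; omega) (fun k s' v h => by simpa using h)
    (by simp [Expr.eval]) ?_).mono ?_)))
  · rintro k hk s' hA hr ⟨hI1, hI2⟩
    have e1 : s'.reg 1 = m := by
      rw [hA.reg 1 (by simp [Program.KeepsReg])]; simp [h1]
    refine Runs.seq (Runs.write (Runs.assign ⟨?_, fun v hv => ?_⟩))
    · simp [Expr.eval, hI1, e1, Nat.succ_mul]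
    · rcases Nat.lt_succ_iff_lt_or_eq.1 hv with hv | rfl
      · simpa [Expr.eval, hr, hv.ne] using hI2 v hv
      · simp [Expr.eval, hr, hI1]
  rintro s₁ hA₁ ⟨-, hI₁⟩
  have e0 : s₁.reg 0 = n := by rw [hA₁.reg 0 (by simp [Program.KeepsReg])]; simp [h0]
  have e1 : s₁.reg 1 = m := by rw [hA₁.reg 1 (by simp [Program.KeepsReg])]; simp [h1]
  have a₁ : ∀ a, a ≠ 2 → s₁.arr a = s.arr a := fun a ha =>
    hA₁.arr a (by simp [Program.KeepsArr, ha])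
  have hcost₁ : ∀ i < n, ∀ e < m, s₁.arr 0 (s₁.arr 2 i + e) = c i e := by
    intro i hi e he
    rw [hI₁ i (by simpa [h0] using hi), a₁ 0 (by omega)]
    exact hc i hi e he
  refine (Runs.forLt (fun k s' => (∀ f < k, InitInv c n n f s') ∧ ∀ f, k ≤ f → s'.arr 1 f = 0)
    (by omega) (by simp [Program.KeepsReg]) (by simp [Program.KeepsReg]) (by omega)
    (fun _ _ _ h => h) ⟨by simp, fun f _ => by rw [a₁ 1 (by omega)]; exact ha1 f⟩ ?_).mono ?_
  · rintro e he s₂ hA₂ hr₂ ⟨hI, hJ⟩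
    rw [e1] at he
    have f0 : s₂.reg 0 = n := by rw [hA₂.reg 0 (by simp [Program.KeepsReg]), e0]
    have hcost₂ : ∀ i < n, s₂.arr 0 (s₂.arr 2 i + e) = c i e := fun i hi => by
      rw [hA₂.arr 0 (by simp [Program.KeepsArr]), hA₂.arr 2 (by simp [Program.KeepsArr])]
      exact hcost₁ i hi e he
    refine Runs.seq (Runs.write ((Runs.forLt (fun k s' => (∀ f < e, InitInv c n n f s') ∧
      (∀ f, e + 1 ≤ f → s'.arr 1 f = 0) ∧ InitInv c n k e s') (by omega)
      (by simp [Program.KeepsReg]) (by simp [Program.KeepsReg]) (by simp; omega)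
      (fun _ _ _ h => h) ⟨fun f hf => ?_, fun f hf => ?_, ?_⟩ ?_).mono ?_))
    · have := hI f hf
      simpa [InitInv, Expr.eval, hr₂, hf.ne] using this
    · simpa using hJ f (by omega)
    -- The owner array is initially zero, so a chore that costs 2 to everybody stays with agent 0 at
    -- price 2.
    · exact .inl ⟨by simp [Expr.eval, hr₂], by simpa using hJ e le_rfl, by simp⟩
    · rintro k hk s₃ hA₃ hr₃ ⟨i1, i2, i3⟩
      have hk : k < n := by simpa [f0] using hk
      have r31 : s₃.reg 31 = e := by
        rw [hA₃.reg 31 (by simp [Program.KeepsReg])]; simpa using hr₂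
      have hcost₃ : s₃.arr 0 (s₃.arr 2 k + e) = c k e := by
        rw [hA₃.arr 0 (by simp [Program.KeepsArr]), hA₃.arr 2 (by simp [Program.KeepsArr])]
        simpa using hcost₂ k hk
      refine Runs.branch (fun hg => Runs.seq (Runs.write (Runs.write ?_)))
        (fun hg => Runs.skip ?_)
      all_goals simp only [costExpr, Expr.holds_eq, Expr.eval, hr₃, r31, hcost₃] at hg
      · refine ⟨fun f hf => ?_, fun f hf => ?_, .inr ⟨?_, ?_, ?_⟩⟩
        · have := i1 f hf
          simpa [InitInv, Expr.eval, r31, hf.ne] using this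
        · have hfe : f ≠ e := by omega
          simpa [Expr.eval, r31, hfe] using i2 f hf
        · simp [Expr.eval, r31]
        · simpa [Expr.eval, r31, hr₃] using hk
        · simpa [Expr.eval, r31, hr₃] using hg
      · refine ⟨i1, i2, ?_⟩
        rcases i3 with ⟨j1, j2, j3⟩ | i3
        · refine .inl ⟨j1, j2, fun v hv => ?_⟩
          rcases Nat.lt_succ_iff_lt_or_eq.1 hv with hv | rfl
          · exact j3 v hv
          · exact hg
        · exact .inr i3
    · rintro s₃ - ⟨i1, i2, i3⟩
      refine ⟨fun f hf => ?_, i2⟩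
      rcases Nat.lt_succ_iff_lt_or_eq.1 hf with hf | rfl
      · exact i1 f hf
      · simpa [f0] using i3
  · rintro s₂ hA₂ ⟨hI, -⟩
    rw [e1] at hI
    have hcost₂ : ∀ i < n, ∀ e < m, (marketOf n m s₂).cost i e = c i e := fun i hi e he => by
      show s₂.arr 0 (s₂.arr 2 i + e) = _
      rw [hA₂.arr 0 (by simp [Program.KeepsArr]), hA₂.arr 2 (by simp [Program.KeepsArr])]
      exact hcost₁ i hi e he
    have hraised : ∀ i, (marketOf n m s₂).raised i = 0 := fun i => by
      show s₂.arr 3 i = 0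
      rw [hA₂.arr 3 (by simp [Program.KeepsArr]), a₁ 3 (by omega)]
      exact ha3 i
    refine ⟨⟨?_, ?_, ⟨0, hn0, hraised 0⟩, ?_, ?_, ?_, ?_⟩, hcost₂, fun i _ => hraised i, ?_, ?_⟩
    · intro i hi e he
      rw [hcost₂ i hi e he]
      exact hc12 i hi e he
    · intro i _
      rw [hraised]
      exact Nat.zero_le _
    · intro e he
      rcases hI e he with h | h
      · exact .inr h.1
      · exact .inl h.1
    · intro e he
      rcases hI e he with h | h
      · exact h.2.1.trans_lt hn0
      · exact h.2.1
    · intro e he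
      show (marketOf n m s₂).raised (s₂.arr 1 e) + (marketOf n m s₂).cost (s₂.arr 1 e) e =
        s₂.arr 4 e
      rw [hraised, zero_add]
      rcases hI e he with h | h
      · rw [h.1, h.2.1, hcost₂ 0 hn0 e he]
        exact (hc12 0 hn0 e he).resolve_left (h.2.2 0 hn0)
      · rw [hcost₂ _ h.2.1 e he, h.1, h.2.2]
    · intro e he i hi
      rw [hraised, zero_add, hcost₂ i hi e he]
      show s₂.arr 4 e ≤ _
      have h12 := hc12 i hi e he
      rcases hI e he with h | h
      · have := h.2.2 i hi
        omega
      · omega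
    · rw [hA₂.reg 0 (by simp [Program.KeepsReg]), e0]
    · rw [hA₂.reg 1 (by simp [Program.KeepsReg]), e1]

end Chores

/-! ### The whole algorithm and its polynomial bound. -/

namespace Chores

open Finset Relation RAM

variable {n m L : ℕ} {s : State}

/-- The algorithm. -/
def mainProg : Program :=
  .seq initProg (.seq (.assign 32 (.const 1)) (.loop (.reg 32) roundProg))

theorem runs_mainProg {c : ℕ → ℕ → ℕ} (hnL : n < L) (hmL : m ≤ L)
    (hL : (n + 1) * Market.potentialBound m + 1 ≤ L) (hn0 : 0 < n) (h0 : s.reg 0 = n)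
    (h1 : s.reg 1 = m) (hc : ∀ i < n, ∀ e < m, s.arr 0 (i * m + e) = c i e)
    (hc12 : ∀ i < n, ∀ e < m, c i e = 1 ∨ c i e = 2) (ha1 : ∀ e, s.arr 1 e = 0)
    (ha3 : ∀ e, s.arr 3 e = 0) :
    Runs L mainProg s fun s' => (marketOf n m s').Valid ∧
      (∀ i < n, ∀ e < m, (marketOf n m s').cost i e = c i e) ∧
      (marketOf n m s').Stuck ∧ (marketOf n m s').Settled ∧ ∃ N, (marketOf n m s').Bounded N := by
  refine Runs.seq ((runs_initProg hnL.le hmL hn0 h0 h1 hc hc12 ha1 ha3).mono ?_)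
  rintro s₁ - ⟨hM, hcost, hraised, e0, e1⟩
  refine Runs.seq (Runs.assign ?_)
  set s₂ := s₁.setReg 32 (Expr.eval s₁ (.const 1)) with hs₂
  refine (Runs.loop (MainInv (marketOf n m s₁).cost n m)
    (fun s' => (marketOf n m s').rank + s'.reg 32) ?_ ?_ ?_).mono ?_
  · refine ⟨by simp [hs₂, e0], by simp [hs₂, e1], hM, rfl, ⟨_, hM.bounded_init hraised⟩, ?_, ?_⟩
    · simp [hs₂, Expr.eval]
    · simp [hs₂, Expr.eval]
  -- The number of rounds is at most the initial rank plus one for the flag.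
  · have h2 := (marketOf n m s₂).rank_le
    have h3 : s₂.reg 32 = 1 := by simp [hs₂, Expr.eval]
    omega
  · intro s' _ hI hg
    have hgo : s'.reg 32 = 1 := by
      have h2 := hI.2.2.2.2.2.1
      rw [Expr.holds_reg] at hg
      omega
    exact runs_roundProg hnL hmL hI hgo
  · rintro s' - ⟨⟨-, -, hv, hc', hb, -, hfin⟩, hg⟩
    have hfin := hfin (not_not.1 hg)
    exact ⟨hv, fun i hi e he => by rw [hc', hcost i hi e he], hfin.1, hfin.2, hb⟩

/-- A bound of the number of repetitions of every loop, as a polynomial in `n + m`. -/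
noncomputable def loopBound : Polynomial ℕ :=
  (.X + 1) * (((3 * .X) ^ 2 * (.X ^ 2 + 1) + .X ^ 2) * (.X ^ 2 + 1) + .X ^ 2 + 1) + .X + 1

theorem eval_loopBound (k : ℕ) :
    loopBound.eval k = (k + 1) * Market.potentialBound k + k + 1 := by
  simp [loopBound, Market.potentialBound]

theorem potentialBound_mono {k l : ℕ} (h : k ≤ l) :
    Market.potentialBound k ≤ Market.potentialBound l := by
  unfold Market.potentialBound
  gcongr

theorem Instance.toState_cost (I : Instance n m) {i e : ℕ} (hi : i < n) (he : e < m) :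
    I.toState.arr 0 (i * m + e) = ⌊I.cost ⟨i, hi⟩ ⟨e, he⟩⌋₊ := by
  have hlt : i * m + e < n * m := by
    calc i * m + e < i * m + m := by omega
      _ = (i + 1) * m := (Nat.succ_mul i m).symm
      _ ≤ n * m := Nat.mul_le_mul_right m hi
  have h1 : Fin.divNat (⟨i * m + e, hlt⟩ : Fin (n * m)) = ⟨i, hi⟩ := by
    ext
    simp only [Fin.coe_divNat]
    rw [mul_comm, Nat.mul_add_div (by omega), Nat.div_eq_of_lt he, add_zero]
  have h2 : Fin.modNat (⟨i * m + e, hlt⟩ : Fin (n * m)) = ⟨e, he⟩ := by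
    ext
    simp only [Fin.coe_modNat]
    rw [mul_comm, Nat.mul_add_mod, Nat.mod_eq_of_lt he]
  simp [Instance.toState, hlt, h1, h2]

/-- A single `L` must exceed `n`, be at least `m` and bound the number of rounds; `loopBound`
achieves this by monotonicity of the potential bound. Rounding down in the input loses nothing for
costs 1 and 2. -/
theorem mainProg_correct (hn0 : 0 < n) (I : Instance n m) (hI : I.IsOneTwo) :
    Runs (loopBound.eval (n + m)) mainProg I.toState fun s => ∃ X : Allocation n m,
      X.IsOutput s ∧ IsEFX I X ∧ IsParetoOptimal I X := by
  have hL := eval_loopBound (n + m)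
  have hmono := potentialBound_mono (Nat.le_add_left m n)
  have hbound : (n + 1) * Market.potentialBound m ≤
      (n + m + 1) * Market.potentialBound (n + m) := Nat.mul_le_mul (by omega) hmono
  have hfloor : ∀ i e, ((⌊I.cost i e⌋₊ : ℕ) : ℝ) = I.cost i e := by
    intro i e
    rcases hI i e with h | h <;> rw [h]
    · simp
    · norm_num
  refine (runs_mainProg (c := fun i e => if h : i < n ∧ e < m then
    ⌊I.cost ⟨i, h.1⟩ ⟨e, h.2⟩⌋₊ else 0) (n := n) (m := m) (by omega) (by omega) (by omega) hn0
    rfl rfl ?_ ?_ (fun _ => rfl) (fun _ => rfl)).mono ?_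
  · intro i hi e he
    rw [I.toState_cost hi he, dif_pos ⟨hi, he⟩]
  · intro i hi e he
    rw [dif_pos ⟨hi, he⟩]
    rcases hI ⟨i, hi⟩ ⟨e, he⟩ with h | h <;> rw [h] <;> norm_num
  · rintro s - ⟨hv, hcost, hs, ht, N, hb⟩
    have hc : ∀ i e, I.cost i e = (marketOf n m s).cost i e := by
      intro i e
      rw [hcost i i.2 e e.2, dif_pos ⟨i.2, e.2⟩, hfloor]
    exact ⟨hv.allocation, fun e i => hv.mem_allocation, hv.isEFX hc hs ht hb,
      hv.isParetoOptimal hc⟩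

end Chores

theorem theorem2 :
    (∀ (n m : ℕ), 0 < n → ∀ I : Chores.Instance n m, I.IsOneTwo →
      ∃ X : Chores.Allocation n m, Chores.IsEFX I X ∧ Chores.IsParetoOptimal I X) ∧
    (∃ (p : RAM.Program) (q : Polynomial ℕ),
      ∀ (n m : ℕ), 0 < n → ∀ I : Chores.Instance n m, I.IsOneTwo →
        ∃ (t : ℕ) (s : RAM.State) (X : Chores.Allocation n m),
          RAM.Exec p I.toState t s ∧ t ≤ q.eval (n + m) ∧ X.IsOutput s ∧
            Chores.IsEFX I X ∧ Chores.IsParetoOptimal I X) := by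
  refine ⟨fun n m hn I hI => ?_, ?_⟩
  · obtain ⟨-, -, -, -, X, -, hX⟩ := Chores.mainProg_correct hn I hI
    exact ⟨X, hX⟩
  · obtain ⟨q, hq⟩ := Chores.mainProg.exists_bound_eq_eval
    -- The running time is polynomial in the loop limit, which is itself polynomial in `n + m`.
    refine ⟨Chores.mainProg, q.comp Chores.loopBound, fun n m hn I hI => ?_⟩
    obtain ⟨t, s, h1, h2, X, h3, h4, h5⟩ := Chores.mainProg_correct hn I hI
    refine ⟨t, s, X, h1, ?_, h3, h4, h5⟩
    rwa [Polynomial.eval_comp, ← hq]
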